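/- Let $d\ge 2$, and let $\mathcal S=C^\infty(\mathbb S^{d-1})$ be the smooth complex functions on the unit sphere of $\mathbb R^d$, with the topology generated by the norms $\|(\mathrm{Id}-\Delta)^n h\|_\infty$, $n\in\mathbb N$ ($\Delta$ the Laplace–Beltrami operator). Let $\mathcal S'$ be its topological dual, with bilinear pairing $\langle\cdot|\cdot\rangle$; an integrable function $f$ is identified with the element $\varphi\mapsto\int f\varphi$ of $\mathcal S'$. For each $n\in\mathbb N$ let $Y_n^1,\dots,Y_n^{N_d(n)}$ be an $L^2$-orthonormal basis of the eigenspace of $\Delta$ for the eigenvalue $-n(n+d-2)$. Let $\mathcal D:\mathcal S\to\mathcal S$, $\mathcal Dh=\sum_n \hat D_n\sum_m \hat h_n^m Y_n^m$ with $\hat h_n^m=\int h\,\overline{Y_n^m}$, be a spherical pseudo-differential operator: $\hat D_n\in\mathbb R$, the set $\mathfrak K_{\mathcal D}=\{n:\hat D_n=0\}$ is finite, and $|\hat D_n|=\Theta(n^p)$ for some $p\ge 0$. It acts on $\mathcal S'$ by $\langle\mathcal D u|\varphi\rangle=\langle u|\mathcal D\varphi\rangle$, and likewise its pseudo-inverse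 $\mathcal D^\dagger h=\sum_{n\notin\mathfrak K_{\mathcal D}}\hat D_n^{-1}\sum_m\hat h_n^mY_n^m$. Its zonal Green kernel is $$\psi_{\mathcal D}(t)=\sum_{n\notin\mathfrak K_{\mathcal D}}\frac{N_d(n)}{a_d\,\hat D_n}P_{n,d}(t),$$ where $a_d$ is the area of $\mathbb S^{d-1}$ and $P_{n,d}$ is the $d$-dimensional ultraspherical polynomial of degree $n$ with $P_{n,d}(1)=1$. Assume that $\mathcal D$ is spline-admissible: for every $\mathbf s\in\mathbb S^{d-1}$ the series for $\psi_{\mathcal D}(\langle\mathbf r,\mathbf s\rangle)$ converges at every $\mathbf r\in\mathbb S^{d-1}$, and the Green function $\mathcal D^\dagger\delta_{\mathbf s}\in\mathcal S'$ is an ordinary (integrable) function. Let $\mathbf r_1,\dots,\mathbf r_M\in\mathbb S^{d-1}$. 1. If $\mathfrak s\in\mathcal S'$ and $\alpha_1,\dots,\alpha_M\in\mathbb C$ satisfy $\mathcal D\mathfrak s=\sum_{i=1}^M\alpha_i\delta_{\mathbf r_i}$ (that is, $\mathfrak s$ is a $\mathcal D$-spline with knots $\mathbf r_i$ and amplitudes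 $\alpha_i$), then $\mathfrak s$ is the ordinary integrable function $$\mathfrak s(\mathbf r)=\sum_{i=1}^M\alpha_i\,\psi_{\mathcal D}(\langle\mathbf r,\mathbf r_i\rangle)+\sum_{n\in\mathfrak K_{\mathcal D}}\sum_{m=1}^{N_d(n)}\hat\beta_n^m\,Y_n^m(\mathbf r),\qquad \hat\beta_n^m=\langle\mathfrak s|\overline{Y_n^m}\rangle$$ (so $\hat\beta_n^m=\langle\mathfrak s|Y_n^m\rangle$ when the $Y_n^m$ are real-valued). 2. If $\mathfrak K_{\mathcal D}=\emptyset$, then every such $\mathfrak s$ equals $\sum_{i=1}^M\alpha_i\,\psi_{\mathcal D}(\langle\cdot,\mathbf r_i\rangle)$; the functions $\psi_{\mathcal D}(\langle\cdot,\mathbf r_i\rangle)$ are integrable, and the space of all $\mathcal D$-splines with knots $\mathbf r_1,\dots,\mathbf r_M$ is exactly $\mathrm{span}\{\psi_{\mathcal D}(\langle\cdot,\mathbf r_i\rangle):i=1,\dots,M\}$. If moreover $p>d-1$, these functions lie in $L^2(\mathbb S^{d-1})$. -/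

import Mathlib

open MeasureTheory Filter Topology
open scoped Manifold ContDiff InnerProductSpace

noncomputable section

namespace Spherical

/-! Throughout, `m` is the dimension of the sphere, so the ambient dimension is `d = m + 1`. -/

/-- The ambient Euclidean space `ℝ^d`, `d = m + 1`. -/
abbrev Ambient (m : ℕ) : Type := EuclideanSpace ℝ (Fin (m + 1))

/-- The unit sphere `𝕊^{d-1} ⊂ ℝ^d`, `d = m + 1`. -/
abbrev Sphere (m : ℕ) : Type := Metric.sphere (0 : Ambient m) 1

/-- The surface (Lebesgue) measure of the sphere. -/
def surface (m : ℕ) : Measure (Sphere m) := (volume : Measure (Ambient m)).toSphere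

instance (m : ℕ) : IsFiniteMeasure (surface m) := by
  unfold surface; infer_instance

/-- The total area of the sphere. -/
def area (m : ℕ) : ℝ := (surface m).real Set.univ

/-! ### Smooth functions, the Laplace-Beltrami operator and generalised functions -/

/-- The complex vector space of smooth functions on the sphere, as a subspace of all functions. -/
def smoothSubmodule (m : ℕ) : Submodule ℂ (Sphere m → ℂ) where
  carrier := {h | ContMDiff (𝓡 m) 𝓘(ℝ, ℂ) ∞ h}
  add_mem' ha hb := ContMDiff.add ha hb
  zero_mem' := contMDiff_const
  smul_mem' c _ hf :=
    ((ContinuousLinearMap.mul ℝ ℂ c).contDiff.contMDiff (n := ∞)).comp hf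

/-- The space `C^∞(𝕊^{d-1})` of smooth complex functions (with its own topology, see below). -/
def TestFun (m : ℕ) : Type := smoothSubmodule m

namespace TestFun

variable {m : ℕ}

instance : AddCommGroup (TestFun m) := inferInstanceAs (AddCommGroup (smoothSubmodule m))
instance : Module ℂ (TestFun m) := inferInstanceAs (Module ℂ (smoothSubmodule m))
instance : FunLike (TestFun m) (Sphere m) ℂ where
  coe h := h.1
  coe_injective := Subtype.coe_injective

theorem contMDiff (h : TestFun m) : ContMDiff (𝓡 m) 𝓘(ℝ, ℂ) ∞ (h : Sphere m → ℂ) := h.2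

theorem continuous (h : TestFun m) : Continuous (h : Sphere m → ℂ) := h.contMDiff.continuous

@[ext] theorem ext {g h : TestFun m} (H : ∀ r, g r = h r) : g = h := DFunLike.ext _ _ H

@[simp] theorem add_apply (g h : TestFun m) (r : Sphere m) : (g + h) r = g r + h r := rfl
@[simp] theorem smul_apply (c : ℂ) (h : TestFun m) (r : Sphere m) : (c • h) r = c * h r := rfl

/-- The pointwise complex conjugate of a smooth function. -/
def conjugate (h : TestFun m) : TestFun m :=
  ⟨fun r => starRingEnd ℂ (h r),
    ((Complex.conjCLE : ℂ →L[ℝ] ℂ).contDiff.contMDiff (n := ∞)).comp h.contMDiff⟩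

/-- The extension of a function on the sphere to `ℝ^d ∖ {0}` that is constant along rays
(with value `0` at the origin). -/
def radialExt (h : Sphere m → ℂ) (x : Ambient m) : ℂ :=
  if hx : x = 0 then 0 else
    h ⟨‖x‖⁻¹ • x, by
      rw [mem_sphere_zero_iff_norm, norm_smul, norm_inv, norm_norm,
        inv_mul_cancel₀ (norm_ne_zero_iff.mpr hx)]⟩

theorem contDiffAt_radialExt (h : TestFun m) {x : Ambient m} (hx : x ≠ 0) :
    ContDiffAt ℝ ∞ (radialExt h) x := by
  have : Fact (Module.finrank ℝ (Ambient m) = m + 1) := ⟨finrank_euclideanSpace_fin⟩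
  let U : TopologicalSpace.Opens (Ambient m) := ⟨{0}ᶜ, isOpen_compl_singleton⟩
  have hU : ∀ u : U, (u : Ambient m) ≠ 0 := fun u => u.2
  let f : U → Ambient m := fun u => ‖(u : Ambient m)‖⁻¹ • (u : Ambient m)
  have hf : ContMDiff 𝓘(ℝ, Ambient m) 𝓘(ℝ, Ambient m) ∞ f := by
    intro u
    refine (contMDiffAt_subtype_iff (f := fun y : Ambient m => ‖y‖⁻¹ • y)).mpr ?_
    refine ContDiffAt.contMDiffAt ?_
    exact ((contDiffAt_norm ℝ (hU u)).inv (norm_ne_zero_iff.mpr (hU u))).smul contDiffAt_id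
  have hf' : ∀ u, f u ∈ Metric.sphere (0 : Ambient m) 1 := by
    intro u
    simp only [f]
    rw [mem_sphere_zero_iff_norm, norm_smul, norm_inv, norm_norm,
        inv_mul_cancel₀ (norm_ne_zero_iff.mpr (hU u))]
  have hp := hf.codRestrict_sphere (n := m) hf'
  have hc : ContMDiff 𝓘(ℝ, Ambient m) 𝓘(ℝ, ℂ) ∞ (fun u : U => radialExt h u) := by
    have := h.contMDiff.comp hp
    convert! this using 1
    ext u
    simp only [radialExt, dif_neg (hU u)]
    rfl
  have := hc ⟨x, hx⟩
  rw [contMDiffAt_subtype_iff (f := radialExt (h : Sphere m → ℂ))] at this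
  exact this.contDiffAt

theorem sphere_ne_zero (r : Sphere m) : (r : Ambient m) ≠ 0 := ne_zero_of_mem_unit_sphere r

/-- The Laplace-Beltrami operator of the sphere: the restriction to the sphere of the Euclidean
Laplacian of the extension that is constant along rays. -/
def laplaceBeltrami : TestFun m →ₗ[ℂ] TestFun m where
  toFun h := ⟨fun r => (Laplacian.laplacian (radialExt h) : Ambient m → ℂ) r, by
    have : Fact (Module.finrank ℝ (Ambient m) = m + 1) := ⟨finrank_euclideanSpace_fin⟩
    intro r
    have h1 : ContDiffAt ℝ ∞ (Laplacian.laplacian (radialExt h) : Ambient m → ℂ) r := by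
      rw [InnerProductSpace.laplacian_eq_iteratedFDeriv_stdOrthonormalBasis]
      refine ContDiffAt.sum fun i _ => ?_
      have h2 : ContDiffAt ℝ ∞ (iteratedFDeriv ℝ 2 (radialExt h)) (r : Ambient m) :=
        (h.contDiffAt_radialExt (sphere_ne_zero r)).iteratedFDeriv_right (i := 2) (by norm_cast)
      exact ((ContinuousMultilinearMap.apply ℝ (fun _ : Fin 2 => Ambient m) ℂ
        _).contDiff.contDiffAt).comp _ h2
    exact h1.contMDiffAt.comp r (contMDiff_coe_sphere (n := m) r)⟩
  map_add' g h := by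
    ext r
    have e : radialExt (g + h : TestFun m) = radialExt (g : Sphere m → ℂ) + radialExt h := by
      ext x; by_cases hx : x = 0 <;> simp [radialExt, hx]
    change (Laplacian.laplacian (radialExt (g + h : TestFun m)) : Ambient m → ℂ) r = _
    rw [e, ((g.contDiffAt_radialExt (sphere_ne_zero r)).of_le (by norm_cast)).laplacian_add
      ((h.contDiffAt_radialExt (sphere_ne_zero r)).of_le (by norm_cast))]
    rfl
  map_smul' c h := by
    ext r
    have e : radialExt (c • h : TestFun m) = c • radialExt (h : Sphere m → ℂ) := by
      ext x; by_cases hx : x = 0 <;> simp [radialExt, hx]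
    change (Laplacian.laplacian (radialExt (c • h : TestFun m)) : Ambient m → ℂ) r = _
    rw [e, InnerProductSpace.laplacian_smul c
      ((h.contDiffAt_radialExt (sphere_ne_zero r)).of_le (by norm_cast))]
    rfl

/-- Smooth functions as continuous functions. -/
def toContₗ : TestFun m →ₗ[ℂ] C(Sphere m, ℂ) where
  toFun h := ⟨h, h.continuous⟩
  map_add' _ _ := rfl
  map_smul' _ _ := rfl

/-- The norms `‖h‖_{n,∞} = ‖(Id - Δ)^n h‖_∞`. -/
def seminormFamily (m : ℕ) : SeminormFamily ℂ (TestFun m) ℕ := fun n =>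
  (normSeminorm ℂ C(Sphere m, ℂ)).comp
    (toContₗ.comp ((LinearMap.id - laplaceBeltrami : TestFun m →ₗ[ℂ] TestFun m) ^ n))

/-- The topology of `C^∞(𝕊^{d-1})` generated by the norms `‖·‖_{n,∞}`. -/
instance : TopologicalSpace (TestFun m) := (seminormFamily m).moduleFilterBasis.topology

theorem withSeminorms (m : ℕ) : WithSeminorms (seminormFamily m) := ⟨rfl⟩

instance : IsTopologicalAddGroup (TestFun m) := (withSeminorms m).topologicalAddGroup
instance : ContinuousSMul ℂ (TestFun m) := (withSeminorms m).continuousSMul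

/-- The continuous inclusion of smooth functions into continuous functions. -/
def toCont : TestFun m →L[ℂ] C(Sphere m, ℂ) where
  toLinearMap := toContₗ
  cont := by
    refine WithSeminorms.continuous_of_continuous_comp
      (norm_withSeminorms ℂ C(Sphere m, ℂ)) toContₗ fun _ => ?_
    exact (withSeminorms m).continuous_seminorm 0

end TestFun

/-- Generalised functions: the topological dual of `C^∞(𝕊^{d-1})`. -/
abbrev GenFun (m : ℕ) : Type := TestFun m →L[ℂ] ℂ

variable {m : ℕ}

/-- The Dirac measure at `r`, as a generalised function. -/
def dirac (r : Sphere m) : GenFun m := (ContinuousMap.evalCLM ℂ r).comp TestFun.toCont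

/-- The generalised function `φ ↦ ∫ f φ` induced by an ordinary (integrable) function `f`. -/
def regular (f : Sphere m → ℂ) (hf : Integrable f (surface m)) : GenFun m :=
  (LinearMap.mkContinuous
    { toFun := fun φ : C(Sphere m, ℂ) => ∫ r, f r * φ r ∂(surface m)
      map_add' := fun φ χ => by
        simp only [ContinuousMap.add_apply, mul_add]
        exact integral_add
          (hf.mul_bdd (c := ‖φ‖) φ.continuous.aestronglyMeasurable
            (ae_of_all _ φ.norm_coe_le_norm))
          (hf.mul_bdd (c := ‖χ‖) χ.continuous.aestronglyMeasurable
            (ae_of_all _ χ.norm_coe_le_norm))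
      map_smul' := fun c φ => by
        simp only [ContinuousMap.smul_apply, smul_eq_mul, RingHom.id_apply, mul_left_comm _ c]
        exact integral_const_mul _ _ }
    (∫ r, ‖f r‖ ∂(surface m))
    (fun φ => by
      simp only [LinearMap.coe_mk, AddHom.coe_mk]
      rw [← integral_mul_const]
      refine norm_integral_le_of_norm_le (hf.norm.mul_const _) (ae_of_all _ fun r => ?_)
      rw [norm_mul]
      exact mul_le_mul_of_nonneg_left (φ.norm_coe_le_norm r) (norm_nonneg _))).comp TestFun.toCont

/-! ### Spherical harmonics -/

/-- The space of spherical harmonics of order `n`: the eigenspace of the Laplace-Beltrami operator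
with eigenvalue `-n(n+d-2)`. -/
def Harm (m n : ℕ) : Submodule ℂ (TestFun m) :=
  Module.End.eigenspace (TestFun.laplaceBeltrami : TestFun m →ₗ[ℂ] TestFun m)
    (-((n : ℂ) * ((n : ℂ) + (m : ℂ) - 1)))

/-- The geometric multiplicity `N_d(n)` of the eigenvalue `-n(n+d-2)`. -/
def harmDim (m n : ℕ) : ℕ := Module.finrank ℂ (Harm m n)

/-- The `L²` inner product `∫ f(r) conj(g(r)) dr`. -/
def l2inner (f g : TestFun m) : ℂ := ∫ r, f r * starRingEnd ℂ (g r) ∂(surface m)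

/-- A choice of orthonormal basis `Y_n^1, …, Y_n^{N_d(n)}` of each space of spherical harmonics. -/
structure HarmonicBasis (m : ℕ) where
  Y : ∀ n : ℕ, Fin (harmDim m n) → TestFun m
  orthonormal : ∀ n i j, l2inner (Y n i) (Y n j) = if i = j then 1 else 0
  span_eq : ∀ n, Submodule.span ℂ (Set.range (Y n)) = Harm m n

/-- The component `∑_k ĥ_n^k Y_n^k` of order `n` in the spherical Fourier expansion of `h`, where
`ĥ_n^k = ⟨h, Y_n^k⟩`. -/
def HarmonicBasis.component (B : HarmonicBasis m) (n : ℕ) (h : TestFun m) : TestFun m :=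
  ∑ k, l2inner h (B.Y n k) • B.Y n k

/-- The `d`-dimensional ultraspherical (Legendre) polynomials, `d = m + 1`, normalised by
`P_{n,d}(1) = 1`, through the recurrence
`(n + d - 2) P_{n+1} = (2n + d - 2) t P_n - n P_{n-1}`. -/
def ultraspherical (m : ℕ) : ℕ → ℝ → ℝ
  | 0, _ => 1
  | 1, t => t
  | n + 2, t => ((2 * n + m + 1 : ℝ) * t * ultraspherical m (n + 1) t
      - (n + 1 : ℝ) * ultraspherical m n t) / (n + m : ℝ)

/-! ### Pseudo-differential operators, Green functions and splines -/

/-- A spherical pseudo-differential operator: a linear operator `D` on `C^∞(𝕊^{d-1})` of the form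
`D h = ∑_n D̂_n ∑_k ĥ_n^k Y_n^k`, with real Fourier symbol `D̂` that has finitely many zeros and
satisfies `|D̂_n| = Θ(n^p)` for some `p ≥ 0`. -/
structure PseudoDiffOp (B : HarmonicBasis m) where
  toLin : TestFun m →ₗ[ℂ] TestFun m
  symbol : ℕ → ℝ
  /-- the spectral growth order `p` -/
  order : ℝ
  hasSum : ∀ (h : TestFun m) (r : Sphere m),
    HasSum (fun n => (symbol n : ℂ) * B.component n h r) (toLin h r)
  finite_zeros : {n : ℕ | symbol n = 0}.Finite
  order_nonneg : 0 ≤ order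
  growth : (fun n : ℕ => |symbol n|) =Θ[atTop] (fun n : ℕ => (n : ℝ) ^ order)

namespace PseudoDiffOp

variable {B : HarmonicBasis m} (D : PseudoDiffOp B)

/-- The finite set of zeros of the Fourier symbol. -/
def zeros : Finset ℕ := D.finite_zeros.toFinset

/-- The Moore-Penrose pseudo-inverse `D† h = ∑_{D̂_n ≠ 0} D̂_n⁻¹ ∑_k ĥ_n^k Y_n^k`. -/
def pinv (h : TestFun m) (r : Sphere m) : ℂ :=
  ∑' n, if n ∈ D.zeros then 0 else ((D.symbol n : ℂ))⁻¹ * B.component n h r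

/-- `Ψ` is the Green function `D† δ_s`, i.e. `⟨Ψ|φ⟩ = ⟨δ_s|D† φ⟩` for all smooth `φ`. -/
def IsGreenFunction (s : Sphere m) (Ψ : GenFun m) : Prop :=
  ∀ φ : TestFun m, Ψ φ = D.pinv φ s

/-- Partial sums of the series `∑_{D̂_n ≠ 0} N_d(n) / (area · D̂_n) P_{n,d}(t)`. -/
def greenPartial (N : ℕ) (t : ℝ) : ℝ :=
  ∑ n ∈ Finset.range N, if n ∈ D.zeros then 0 else
    (harmDim m n : ℝ) / (area m * D.symbol n) * ultraspherical m n t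

/-- The zonal Green kernel `ψ_D(t)`: the sum of the series above (where it converges). -/
def greenKernel (t : ℝ) : ℝ := limUnder atTop (fun N => D.greenPartial N t)

/-- The trace `r ↦ ψ_D(⟨r, s⟩)` of the zonal Green kernel. -/
def trace (s r : Sphere m) : ℂ := (D.greenKernel (inner ℝ (r : Ambient m) (s : Ambient m)) : ℝ)

/-- `D` is spline-admissible if the traces of the zonal Green kernel are ordinary, pointwise defined
functions: the series defining `ψ_D(⟨r, s⟩)` converges at every point `r`, and the generalised
function `D† δ_s` is induced by some integrable function. -/
def IsSplineAdmissible : Prop :=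
  ∀ s : Sphere m,
    (∀ r : Sphere m, ∃ l : ℝ,
      Tendsto (fun N => D.greenPartial N (inner ℝ (r : Ambient m) (s : Ambient m))) atTop (𝓝 l)) ∧
    ∃ (f : Sphere m → ℂ) (hf : Integrable f (surface m)), D.IsGreenFunction s (regular f hf)

/-- The extension of `D` to generalised functions, `⟨D u|φ⟩ = ⟨u|D φ⟩`. -/
def dualApply (u : GenFun m) : TestFun m →ₗ[ℂ] ℂ := (u : TestFun m →ₗ[ℂ] ℂ).comp D.toLin

/-- `u` is a `D`-spline with knots `r_i` and amplitudes `α_i`: `D u = ∑ α_i δ_{r_i}`. -/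
def IsSpline {M : ℕ} (r : Fin M → Sphere m) (α : Fin M → ℂ) (u : GenFun m) : Prop :=
  D.dualApply u = ((∑ i, α i • dirac (r i) : GenFun m) : TestFun m →ₗ[ℂ] ℂ)

/-- The linear space of `D`-splines with knots among `r_1, …, r_M`. -/
def splineSpace {M : ℕ} (r : Fin M → Sphere m) : Submodule ℂ (GenFun m) where
  carrier := {u | ∃ α : Fin M → ℂ, D.IsSpline r α u}
  add_mem' := by
    rintro u v ⟨α, hα⟩ ⟨β, hβ⟩
    refine ⟨α + β, ?_⟩
    ext φ
    have h1 := LinearMap.congr_fun hα φ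
    have h2 := LinearMap.congr_fun hβ φ
    simp only [dualApply, LinearMap.comp_apply, ContinuousLinearMap.coe_coe,
      sum_apply, smul_apply] at h1 h2
    simp [dualApply, h1, h2, add_mul, Finset.sum_add_distrib]
  zero_mem' := ⟨0, by ext φ; simp [dualApply]⟩
  smul_mem' := by
    rintro c u ⟨α, hα⟩
    refine ⟨c • α, ?_⟩
    ext φ
    have h1 := LinearMap.congr_fun hα φ
    simp only [dualApply, LinearMap.comp_apply, ContinuousLinearMap.coe_coe,
      sum_apply, smul_apply] at h1
    simp [dualApply, h1, Finset.mul_sum, mul_assoc]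

end PseudoDiffOp

end Spherical

end

/-!
A spline and its candidate formula are compared on each eigenspace of `Δ`: off the zeros of the
symbol the spline equation can be solved, on the zeros only the harmonic part survives. This is
enough because harmonics are dense in `C^∞(𝕊^{d-1})`. Powers of `⟨·, s⟩` are sums of harmonics, so
harmonics are uniformly dense by Stone-Weierstrass; applied to `(Id - Δ)^n h`, this gives density in
the norms `‖(Id - Δ)^n ·‖_∞` because, by the maximum principle, `(Id - Δ)⁻¹` does not increase sup
norms.

The analytic point is that the Green function `D† δ_s`, known only to be some integrable function,
agrees almost everywhere with the pointwise sum of the zonal series. Its `n`-th term is zonal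
because the reproducing kernel of the harmonics of order `n` is `N_d(n) / a_d · P_{n,d}(⟨r, s⟩)`.
Multiply the `n`-th term by `(1 + ε n(n+d-2))^{-(d-1)}`, that is, apply `(Id - ε Δ)^{-(d-1)}`: the
series now converges uniformly. As `ε → 0` the smoothed series tends to `ψ_D(⟨·, s⟩)` pointwise, by
Abel summation, and to the Green function in `L¹`, because smoothing does not increase sup norms and
hence, by duality, does not increase `L¹` norms.
-/

noncomputable section

namespace Spherical

variable {m : ℕ}

/-! ### The Laplacian through second derivatives along lines -/

section Lines

variable {E F : Type*} [NormedAddCommGroup E] [NormedSpace ℝ E]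
  [NormedAddCommGroup F] [NormedSpace ℝ F]

theorem continuous_line (x v : E) : Continuous fun t : ℝ => x + t • v := by fun_prop

theorem tendsto_line_zero (x v : E) : Tendsto (fun t : ℝ => x + t • v) (𝓝 0) (𝓝 x) := by
  simpa using (continuous_line x v).tendsto 0

theorem hasDerivAt_comp_line {f : E → F} {x v : E} {t : ℝ}
    (hf : DifferentiableAt ℝ f (x + t • v)) :
    HasDerivAt (fun t : ℝ => f (x + t • v)) (fderiv ℝ f (x + t • v) v) t := by
  have hline : HasDerivAt (fun t : ℝ => x + t • v) v t := by
    simpa using ((hasDerivAt_id t).smul_const v).const_add x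
  exact hf.hasFDerivAt.comp_hasDerivAt t hline

theorem fderiv_fderiv_apply_self {f : E → F} {x : E} (hf : ContDiffAt ℝ 2 f x) (v : E) :
    fderiv ℝ (fun y => fderiv ℝ f y v) x v = iteratedFDeriv ℝ 2 f x ![v, v] := by
  have hd : DifferentiableAt ℝ (fderiv ℝ f) x :=
    (hf.fderiv_right (m := 1) (by norm_num)).differentiableAt (by simp)
  rw [(hd.hasFDerivAt.clm_apply (hasFDerivAt_const v x)).fderiv, iteratedFDeriv_two_apply]
  simp

theorem iteratedFDeriv_two_eq_deriv_deriv {f : E → F} {x : E} (hf : ContDiffAt ℝ 2 f x) (v : E) :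
    iteratedFDeriv ℝ 2 f x ![v, v] = deriv (deriv fun t : ℝ => f (x + t • v)) 0 := by
  have hderiv : deriv (fun t : ℝ => f (x + t • v)) =ᶠ[𝓝 0] fun t => fderiv ℝ f (x + t • v) v := by
    filter_upwards [(tendsto_line_zero x v).eventually (hf.eventually (by simp))] with t ht
    exact (hasDerivAt_comp_line (ht.differentiableAt (by simp))).deriv
  have hd : DifferentiableAt ℝ (fderiv ℝ f) (x + (0 : ℝ) • v) := by
    rw [zero_smul, add_zero]
    exact (hf.fderiv_right (m := 1) (by norm_num)).differentiableAt (by simp)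
  rw [hderiv.deriv_eq, ((hasDerivAt_comp_line hd).clm_apply (hasDerivAt_const (0 : ℝ) v)).deriv,
    iteratedFDeriv_two_apply]
  simp

theorem deriv_deriv_comp_mul_left (c : ℝ) (g : ℝ → F) (t : ℝ) :
    deriv (deriv fun t => g (c * t)) t = c ^ 2 • deriv (deriv g) (c * t) := by
  have hderiv : (deriv fun t => g (c * t)) = fun t => c • deriv g (c * t) := by
    ext t
    exact deriv_comp_mul_left _ _ _
  rw [hderiv, deriv_fun_const_smul_field, deriv_comp_mul_left (c := c) (f := deriv g), smul_smul,
    sq]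

theorem deriv_deriv_nonpos_of_isLocalMax {g : ℝ → ℝ} {a : ℝ} (hg : IsLocalMax g a)
    (hc : ContinuousAt g a) : deriv (deriv g) a ≤ 0 := by
  by_contra! hpos
  have hmin := isLocalMin_of_deriv_deriv_pos hpos hg.deriv_eq_zero hc
  have hconst : g =ᶠ[𝓝 a] fun _ => g a := by
    filter_upwards [hg, hmin] with x hle hge using le_antisymm hle hge
  have hzero : deriv (deriv g) a = 0 := by
    rw [hconst.deriv.deriv_eq]; simp
  exact hpos.ne' hzero

end Lines

section Laplacian

variable {E F : Type*} [NormedAddCommGroup E] [InnerProductSpace ℝ E] [FiniteDimensional ℝ E]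
  [NormedAddCommGroup F] [NormedSpace ℝ F]

theorem laplacian_eq_sum_deriv_deriv {f : E → F} {x : E} (hf : ContDiffAt ℝ 2 f x) {ι : Type*}
    [Fintype ι] (b : OrthonormalBasis ι ℝ E) :
    (Laplacian.laplacian f : E → F) x = ∑ i, deriv (deriv fun t : ℝ => f (x + t • b i)) 0 := by
  rw [InnerProductSpace.laplacian_eq_iteratedFDeriv_orthonormalBasis _ b]
  exact Finset.sum_congr rfl fun i _ => iteratedFDeriv_two_eq_deriv_deriv hf (b i)

theorem laplacian_nonpos_of_isLocalMax {f : E → ℝ} {x : E} (hf : ContDiffAt ℝ 2 f x)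
    (hx : IsLocalMax f x) : (Laplacian.laplacian f : E → ℝ) x ≤ 0 := by
  rw [laplacian_eq_sum_deriv_deriv hf (stdOrthonormalBasis ℝ E)]
  refine Finset.sum_nonpos fun i _ => deriv_deriv_nonpos_of_isLocalMax ?_ ?_
  · simpa [IsLocalMax, IsMaxFilter] using (tendsto_line_zero x _).eventually hx
  · refine ContinuousAt.comp (g := f) ?_ (continuous_line x _).continuousAt
    simpa using hf.continuousAt

theorem laplacian_comp_linearIsometryEquiv {f : E → F} (R : E ≃ₗᵢ[ℝ] E) {x : E}
    (hf : ContDiffAt ℝ 2 f (R x)) :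
    (Laplacian.laplacian (f ∘ R) : E → F) x = (Laplacian.laplacian f : E → F) (R x) := by
  have hcomp : ContDiffAt ℝ 2 (f ∘ R) x :=
    hf.comp x R.toContinuousLinearEquiv.contDiff.contDiffAt
  rw [laplacian_eq_sum_deriv_deriv hcomp (stdOrthonormalBasis ℝ E),
    laplacian_eq_sum_deriv_deriv hf ((stdOrthonormalBasis ℝ E).map R)]
  simp only [Function.comp_apply, map_add, map_smul, OrthonormalBasis.map_apply]

theorem laplacian_comp_smul {f : E → F} {c : ℝ} {x : E} (hf : ContDiffAt ℝ 2 f (c • x)) :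
    (Laplacian.laplacian (fun y => f (c • y)) : E → F) x =
      c ^ 2 • (Laplacian.laplacian f : E → F) (c • x) := by
  have hcomp : ContDiffAt ℝ 2 (fun y => f (c • y)) x :=
    hf.comp x (contDiff_const_smul c).contDiffAt
  rw [laplacian_eq_sum_deriv_deriv hcomp (stdOrthonormalBasis ℝ E),
    laplacian_eq_sum_deriv_deriv hf (stdOrthonormalBasis ℝ E), Finset.smul_sum]
  refine Finset.sum_congr rfl fun i _ => ?_
  simp only [smul_add, smul_smul]
  simpa using deriv_deriv_comp_mul_left c
    (fun t => f (c • x + t • stdOrthonormalBasis ℝ E i)) 0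

variable [MeasurableSpace E] [BorelSpace E]

theorem integrable_mul_of_continuousAt_tsupport {P Q : E → ℂ} (hP : Continuous P)
    (hPc : HasCompactSupport P) (hQ : ∀ x ∈ tsupport P, ContinuousAt Q x) :
    Integrable fun x => P x * Q x :=
  Continuous.integrable_of_hasCompactSupport
    (continuous_of_tsupport fun x hx =>
      hP.continuousAt.mul (hQ x (tsupport_mul_subset_left hx))) hPc.mul_right

theorem integral_mul_laplacian_eq_neg_integral_sum_fderiv {A G : E → ℂ} (hA : ContDiff ℝ 1 A)
    (hAc : HasCompactSupport A) (hG : ∀ x ∈ tsupport A, ContDiffAt ℝ 2 G x) {ι : Type*}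
    [Fintype ι] (b : OrthonormalBasis ι ℝ E) :
    ∫ x, A x * (Laplacian.laplacian G : E → ℂ) x =
      -∫ x, ∑ i, fderiv ℝ A x (b i) * fderiv ℝ G x (b i) := by
  have hA' : ∀ v, Continuous fun x => fderiv ℝ A x v := fun v =>
    (hA.continuous_fderiv (by simp)).clm_apply continuous_const
  have hG' : ∀ v, ∀ x ∈ tsupport A, ContDiffAt ℝ 1 (fun y => fderiv ℝ G y v) x := fun v x hx =>
    ((hG x hx).fderiv_right (m := 1) (by norm_num)).clm_apply contDiffAt_const
  have hG'' : ∀ v, ∀ x ∈ tsupport A,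
      ContinuousAt (fun y => fderiv ℝ (fun z => fderiv ℝ G z v) y v) x := fun v x hx =>
    (((hG' v x hx).fderiv_right (m := 0) (by simp)).clm_apply contDiffAt_const).continuousAt
  have hint : ∀ v, Integrable fun x => A x * fderiv ℝ (fun z => fderiv ℝ G z v) x v := fun v =>
    integrable_mul_of_continuousAt_tsupport hA.continuous hAc (hG'' v)
  have hint' : ∀ v, Integrable fun x => fderiv ℝ A x v * fderiv ℝ G x v := fun v =>
    integrable_mul_of_continuousAt_tsupport (hA' v) (hAc.fderiv_apply ℝ v) fun x hx =>
      (hG' v x (tsupport_fderiv_apply_subset ℝ v hx)).continuousAt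
  have hparts : ∀ v, ∫ x, A x * fderiv ℝ (fun z => fderiv ℝ G z v) x v =
      -∫ x, fderiv ℝ A x v * fderiv ℝ G x v := fun v =>
    integral_mul_fderiv_eq_neg_fderiv_mul_of_integrable (𝕜 := ℂ) (hint' v) (hint v)
      (integrable_mul_of_continuousAt_tsupport hA.continuous hAc fun x hx =>
        (hG' v x hx).continuousAt)
      (fun x _ => hA.differentiable (by simp) x)
      fun x hx => (hG' v x hx).differentiableAt (by simp)
  calc ∫ x, A x * (Laplacian.laplacian G : E → ℂ) x
      = ∫ x, ∑ i, A x * fderiv ℝ (fun z => fderiv ℝ G z (b i)) x (b i) := by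
        refine integral_congr_ae (ae_of_all _ fun x => ?_)
        dsimp only
        rw [← Finset.mul_sum]
        by_cases hx : x ∈ tsupport A
        · rw [InnerProductSpace.laplacian_eq_iteratedFDeriv_orthonormalBasis _ b]
          simp only [fderiv_fderiv_apply_self (hG x hx)]
        · rw [image_eq_zero_of_notMem_tsupport hx, zero_mul, zero_mul]
    _ = -∫ x, ∑ i, fderiv ℝ A x (b i) * fderiv ℝ G x (b i) := by
        rw [integral_finsetSum _ fun i _ => hint (b i),
          integral_finsetSum _ fun i _ => hint' (b i), ← Finset.sum_neg_distrib]
        exact Finset.sum_congr rfl fun i _ => hparts (b i)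

end Laplacian

/-! ### Radial extensions and the maximum principle -/

namespace TestFun

theorem laplaceBeltrami_apply (h : TestFun m) (r : Sphere m) :
    laplaceBeltrami h r = (Laplacian.laplacian (radialExt h) : Ambient m → ℂ) r := rfl

theorem contDiffAt_two_radialExt (h : TestFun m) {x : Ambient m} (hx : x ≠ 0) :
    ContDiffAt ℝ 2 (radialExt h) x := (h.contDiffAt_radialExt hx).of_le (by norm_cast)

/-- The radial projection of a nonzero vector onto the sphere. -/
def normalize (x : Ambient m) (hx : x ≠ 0) : Sphere m :=
  ⟨‖x‖⁻¹ • x, by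
    rw [mem_sphere_zero_iff_norm, norm_smul, norm_inv, norm_norm,
      inv_mul_cancel₀ (norm_ne_zero_iff.mpr hx)]⟩

theorem coe_normalize (x : Ambient m) (hx : x ≠ 0) :
    (normalize x hx : Ambient m) = ‖x‖⁻¹ • x := rfl

theorem radialExt_of_ne (h : Sphere m → ℂ) {x : Ambient m} (hx : x ≠ 0) :
    radialExt h x = h (normalize x hx) := dif_neg hx

@[simp] theorem radialExt_zero (h : Sphere m → ℂ) : radialExt h 0 = 0 := dif_pos rfl

@[simp] theorem radialExt_coe (h : Sphere m → ℂ) (r : Sphere m) : radialExt h r = h r := by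
  rw [radialExt_of_ne h (sphere_ne_zero r)]
  congr 1
  ext1
  simp [coe_normalize]

theorem radialExt_smul (h : Sphere m → ℂ) {c : ℝ} (hc : 0 < c) (x : Ambient m) :
    radialExt h (c • x) = radialExt h x := by
  rcases eq_or_ne x 0 with rfl | hx
  · simp
  · rw [radialExt_of_ne h hx, radialExt_of_ne h (smul_ne_zero hc.ne' hx)]
    congr 1
    ext1
    simp only [coe_normalize, norm_smul, Real.norm_eq_abs, abs_of_pos hc, smul_smul]
    congr 1
    field_simp

theorem norm_radialExt_le {h : Sphere m → ℂ} {C : ℝ} (hC : 0 ≤ C) (hh : ∀ r, ‖h r‖ ≤ C)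
    (x : Ambient m) : ‖radialExt h x‖ ≤ C := by
  rcases eq_or_ne x 0 with rfl | hx
  · simpa using hC
  · simpa only [radialExt_of_ne h hx] using hh _

theorem re_mul_laplaceBeltrami_nonpos (h : TestFun m) {c : ℂ} {r : Sphere m} (hc : ‖c‖ = 1)
    (hcr : ‖h r‖ = c * h r) (hmax : ∀ q, ‖h q‖ ≤ ‖h r‖) : (c * laplaceBeltrami h r).re ≤ 0 := by
  let L : ℂ →L[ℝ] ℝ := Complex.reCLM.comp (ContinuousLinearMap.mul ℝ ℂ c)
  have hL : ∀ z, L z = (c * z).re := fun z => rfl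
  have hcd := h.contDiffAt_two_radialExt (sphere_ne_zero r)
  have hloc : IsLocalMax (L ∘ radialExt h) (r : Ambient m) := by
    refine Eventually.of_forall fun x => ?_
    simp only [Function.comp_apply, hL, radialExt_coe, ← hcr, Complex.ofReal_re]
    calc (c * radialExt h x).re ≤ ‖c * radialExt h x‖ := Complex.re_le_norm _
      _ = ‖radialExt h x‖ := by rw [norm_mul, hc, one_mul]
      _ ≤ ‖h r‖ := norm_radialExt_le (norm_nonneg _) hmax x
  have hlap := laplacian_nonpos_of_isLocalMax (L.contDiff.contDiffAt.comp _ hcd) hloc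
  rwa [hcd.laplacian_CLM_comp_left] at hlap

theorem norm_le_of_norm_sub_laplaceBeltrami_le (h : TestFun m) {ε : ℝ} (hε : 0 ≤ ε) {C : ℝ}
    (hC : ∀ r, ‖h r - ε * laplaceBeltrami h r‖ ≤ C) (r : Sphere m) : ‖h r‖ ≤ C := by
  obtain ⟨r₀, -, hr₀⟩ := isCompact_univ.exists_isMaxOn ⟨r, Set.mem_univ r⟩
    h.continuous.norm.continuousOn
  have hmax : ∀ q, ‖h q‖ ≤ ‖h r₀‖ := fun q => hr₀ (Set.mem_univ q)
  obtain ⟨c, hc, hcr⟩ := RCLike.exists_norm_eq_mul_self (h r₀)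
  have hlap := h.re_mul_laplaceBeltrami_nonpos hc hcr hmax
  calc ‖h r‖ ≤ ‖h r₀‖ := hmax r
    _ ≤ ‖h r₀‖ - ε * (c * laplaceBeltrami h r₀).re := by nlinarith
    _ = (c * (h r₀ - ε * laplaceBeltrami h r₀)).re := by
      rw [mul_sub, ← hcr, mul_left_comm, Complex.sub_re, Complex.re_ofReal_mul]
      rfl
    _ ≤ ‖c * (h r₀ - ε * laplaceBeltrami h r₀)‖ := Complex.re_le_norm _
    _ ≤ C := by rw [norm_mul, hc, one_mul]; exact hC r₀

theorem laplacian_radialExt (h : TestFun m) {x : Ambient m} (hx : x ≠ 0) :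
    (Laplacian.laplacian (radialExt h) : Ambient m → ℂ) x =
      ((‖x‖ ^ 2 : ℝ) : ℂ)⁻¹ * radialExt (laplaceBeltrami h) x := by
  have hn : 0 < ‖x‖⁻¹ := inv_pos.mpr (norm_pos_iff.mpr hx)
  have hscale : radialExt h = fun y => radialExt h (‖x‖⁻¹ • y) :=
    funext fun y => (radialExt_smul h hn y).symm
  conv_lhs => rw [hscale]
  rw [laplacian_comp_smul (h.contDiffAt_two_radialExt (smul_ne_zero hn.ne' hx)),
    radialExt_of_ne _ hx, laplaceBeltrami_apply, coe_normalize, Complex.real_smul]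
  simp

theorem fderiv_radialExt_self (h : TestFun m) {x : Ambient m} (hx : x ≠ 0) :
    fderiv ℝ (radialExt h) x x = 0 := by
  have hderiv : HasDerivAt (fun t : ℝ => radialExt h (x + t • x))
      (fderiv ℝ (radialExt h) (x + (0 : ℝ) • x) x) 0 := by
    refine hasDerivAt_comp_line ?_
    simpa using (h.contDiffAt_two_radialExt hx).differentiableAt (by simp)
  have hconst : (fun t : ℝ => radialExt h (x + t • x)) =ᶠ[𝓝 0] fun _ => radialExt h x := by
    filter_upwards [eventually_gt_nhds (show (-1 : ℝ) < 0 by norm_num)] with t ht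
    rw [show x + t • x = (1 + t) • x by rw [add_smul, one_smul]]
    exact radialExt_smul h (by linarith) x
  simpa using hderiv.unique ((hasDerivAt_const (0 : ℝ) _).congr_of_eventuallyEq hconst)

@[simp] theorem conjugate_apply (h : TestFun m) (r : Sphere m) :
    h.conjugate r = starRingEnd ℂ (h r) := rfl

theorem laplaceBeltrami_conjugate (h : TestFun m) :
    laplaceBeltrami h.conjugate = (laplaceBeltrami h).conjugate := by
  ext r
  have hext : radialExt h.conjugate = (Complex.conjCLE : ℂ →L[ℝ] ℂ) ∘ radialExt h := by
    ext x
    by_cases hx : x = 0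
    · simp [hx]
    · simp [radialExt_of_ne _ hx]
  rw [laplaceBeltrami_apply, hext,
    (h.contDiffAt_two_radialExt (sphere_ne_zero r)).laplacian_CLM_comp_left]
  rfl

/-! ### Isometries of the sphere -/

/-- The action on the sphere of a linear isometry of the ambient space. -/
def sphereMap (R : Ambient m ≃ₗᵢ[ℝ] Ambient m) (r : Sphere m) : Sphere m :=
  ⟨R r, by rw [mem_sphere_zero_iff_norm, R.norm_map]; simp⟩

@[simp] theorem coe_sphereMap (R : Ambient m ≃ₗᵢ[ℝ] Ambient m) (r : Sphere m) :
    (sphereMap R r : Ambient m) = R r := rfl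

theorem contMDiff_sphereMap (R : Ambient m ≃ₗᵢ[ℝ] Ambient m) :
    ContMDiff (𝓡 m) (𝓡 m) ∞ (sphereMap R) := by
  have : Fact (Module.finrank ℝ (Ambient m) = m + 1) := ⟨finrank_euclideanSpace_fin⟩
  have hR : ContMDiff (𝓡 m) 𝓘(ℝ, Ambient m) ∞ (fun r : Sphere m => R r) :=
    R.toContinuousLinearEquiv.contDiff.contMDiff.comp (contMDiff_coe_sphere (n := m))
  exact hR.codRestrict_sphere (n := m) _

/-- The pullback of a smooth function by a linear isometry. -/
def compIsometry (h : TestFun m) (R : Ambient m ≃ₗᵢ[ℝ] Ambient m) : TestFun m :=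
  ⟨fun r => h (sphereMap R r), h.contMDiff.comp (contMDiff_sphereMap R)⟩

@[simp] theorem compIsometry_apply (h : TestFun m) (R : Ambient m ≃ₗᵢ[ℝ] Ambient m)
    (r : Sphere m) : h.compIsometry R r = h (sphereMap R r) := rfl

theorem radialExt_compIsometry (h : TestFun m) (R : Ambient m ≃ₗᵢ[ℝ] Ambient m) :
    radialExt (h.compIsometry R) = radialExt h ∘ R := by
  ext x
  by_cases hx : x = 0
  · simp [hx]
  · rw [Function.comp_apply, radialExt_of_ne _ hx,
      radialExt_of_ne _ (by simpa using hx : R x ≠ 0), compIsometry_apply]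
    congr 1
    ext1
    simp [coe_normalize]

theorem laplaceBeltrami_compIsometry (h : TestFun m) (R : Ambient m ≃ₗᵢ[ℝ] Ambient m) :
    laplaceBeltrami (h.compIsometry R) = (laplaceBeltrami h).compIsometry R := by
  ext r
  have hcd : ContDiffAt ℝ 2 (radialExt h) (R r) :=
    h.contDiffAt_two_radialExt (sphere_ne_zero (sphereMap R r))
  rw [laplaceBeltrami_apply, radialExt_compIsometry, laplacian_comp_linearIsometryEquiv R hcd]
  rfl

end TestFun

open TestFun

open scoped Pointwise in
theorem measurePreserving_sphereMap (R : Ambient m ≃ₗᵢ[ℝ] Ambient m) :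
    MeasurePreserving (sphereMap R) (surface m) (surface m) := by
  have hc : Continuous (sphereMap R) := (contMDiff_sphereMap R).continuous
  refine ⟨hc.measurable, ?_⟩
  ext s hs
  rw [Measure.map_apply hc.measurable hs, surface, Measure.toSphere_apply' _ hs,
    Measure.toSphere_apply' _ (hc.measurable hs)]
  congr 1
  rw [← R.measurePreserving.measure_preimage_emb R.toHomeomorph.measurableEmbedding
    (Set.Ioo (0 : ℝ) 1 • (Subtype.val '' s))]
  congr 1
  ext x
  simp only [Set.mem_smul, Set.mem_image, Set.mem_preimage]
  constructor
  · rintro ⟨c, hc, _, ⟨q, hq, rfl⟩, rfl⟩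
    exact ⟨c, hc, R q, ⟨_, hq, rfl⟩, by simp⟩
  · rintro ⟨c, hc, _, ⟨q, hq, rfl⟩, hx⟩
    have hq' : sphereMap R (sphereMap R.symm q) = q := by
      ext1; simp
    refine ⟨c, hc, _, ⟨sphereMap R.symm q, by rwa [hq'], rfl⟩, R.injective ?_⟩
    simpa using hx

/-! ### Symmetry of the Laplace-Beltrami operator -/

theorem integral_norm_mul_radialExt (ψ : ℝ → ℂ) (G : Sphere m → ℂ) :
    ∫ x : Ambient m, ψ ‖x‖ * radialExt G x =
      (∫ r, G r ∂(surface m)) * ∫ y : Set.Ioi (0 : ℝ), ψ y ∂(Measure.volumeIoiPow m) := by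
  have hdim : Module.finrank ℝ (Ambient m) - 1 = m := by simp
  calc
    ∫ x : Ambient m, ψ ‖x‖ * radialExt G x
      = ∫ x : ({(0)}ᶜ : Set (Ambient m)), ψ ‖x.1‖ * radialExt G x.1
          ∂(Measure.comap (↑) (volume : Measure (Ambient m))) := by
      rw [integral_subtype_comap (measurableSet_singleton _).compl
        fun x => ψ ‖x‖ * radialExt G x, restrict_compl_singleton]
    _ = ∫ z : Sphere m × Set.Ioi (0 : ℝ), G z.1 * ψ z.2
          ∂((volume : Measure (Ambient m)).toSphere.prod (Measure.volumeIoiPow m)) := by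
      have hmp := (volume : Measure (Ambient m)).measurePreserving_homeomorphUnitSphereProd
      rw [hdim] at hmp
      rw [← hmp.integral_comp (Homeomorph.measurableEmbedding _)]
      refine integral_congr_ae (ae_of_all _ fun x => ?_)
      simp only [homeomorphUnitSphereProd_apply_snd_coe]
      rw [mul_comm, radialExt_of_ne G x.2]
      congr 2
      ext1
      rw [homeomorphUnitSphereProd_apply_fst_coe]
      rfl
    _ = _ := integral_prod_mul G fun y : Set.Ioi (0 : ℝ) => ψ y

/-- A bump function on the positive half-line; composed with `‖x‖²` it localises radial extensions
to an annulus. -/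
def radialBump : ContDiffBump (2 : ℝ) := ⟨1 / 2, 1, by norm_num, by norm_num⟩

theorem radialBump_norm_sq_eq_zero {x : Ambient m} (hx : ‖x‖ ≤ 1 ∨ 2 ≤ ‖x‖) :
    radialBump (‖x‖ ^ 2) = 0 := by
  refine radialBump.zero_of_le_dist ?_
  simp only [radialBump, Real.dist_eq]
  rcases hx with hx | hx
  · have : ‖x‖ ^ 2 ≤ 1 := pow_le_one₀ (norm_nonneg _) hx
    rw [abs_sub_comm]; exact le_trans (by linarith) (le_abs_self _)
  · have : 4 ≤ ‖x‖ ^ 2 := by nlinarith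
    exact le_trans (by linarith) (le_abs_self _)

theorem hasCompactSupport_radialBump_norm_sq :
    HasCompactSupport fun x : Ambient m => radialBump (‖x‖ ^ 2) :=
  HasCompactSupport.intro (isCompact_closedBall (0 : Ambient m) 2) fun x hx =>
    radialBump_norm_sq_eq_zero (Or.inr (le_of_lt (by simpa using hx)))

/-- A smooth radial weight supported in an annulus. The factor `‖x‖²` cancels the homogeneity of
the Laplacian of a radial extension. -/
def cutoff (x : Ambient m) : ℝ := ‖x‖ ^ 2 * radialBump (‖x‖ ^ 2)

theorem contDiff_cutoff : ContDiff ℝ ∞ (cutoff (m := m)) :=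
  (contDiff_norm_sq ℝ).mul (radialBump.contDiff.comp (contDiff_norm_sq ℝ))

theorem hasCompactSupport_cutoff_mul (F : Ambient m → ℂ) :
    HasCompactSupport fun x => (cutoff x : ℂ) * F x :=
  (HasCompactSupport.comp_left (g := Complex.ofReal)
    (hasCompactSupport_radialBump_norm_sq.mul_left (f := fun x : Ambient m => ‖x‖ ^ 2))
    Complex.ofReal_zero).mul_right

theorem eventually_cutoff_eq_zero : ∀ᶠ x in 𝓝 (0 : Ambient m), cutoff x = 0 := by
  filter_upwards [Metric.ball_mem_nhds (0 : Ambient m) one_pos] with x hx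
  rw [cutoff, radialBump_norm_sq_eq_zero (Or.inl (le_of_lt (by simpa using hx))), mul_zero]

theorem ne_zero_of_mem_tsupport_cutoff_mul {F : Ambient m → ℂ} {x : Ambient m}
    (hx : x ∈ tsupport fun x => (cutoff x : ℂ) * F x) : x ≠ 0 := by
  rintro rfl
  refine notMem_tsupport_iff_eventuallyEq.mpr ?_ hx
  filter_upwards [eventually_cutoff_eq_zero] with x hx
  simp [hx]

theorem contDiff_cutoff_mul_radialExt (f : TestFun m) :
    ContDiff ℝ ∞ fun x => (cutoff x : ℂ) * radialExt f x := by
  refine contDiff_iff_contDiffAt.mpr fun x => ?_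
  rcases eq_or_ne x 0 with rfl | hx
  · refine contDiffAt_const (c := (0 : ℂ)) |>.congr_of_eventuallyEq ?_
    filter_upwards [eventually_cutoff_eq_zero] with x hx
    simp [hx]
  · exact (Complex.ofRealCLM.contDiff.comp contDiff_cutoff).contDiffAt.mul
      (f.contDiffAt_radialExt hx)

theorem exists_fderiv_cutoff_eq (x : Ambient m) :
    ∃ c : ℝ, fderiv ℝ cutoff x = c • innerSL ℝ x := by
  have hsq := (hasStrictFDerivAt_norm_sq x).hasFDerivAt
  have hprofile : DifferentiableAt ℝ (fun t => t * radialBump t) (‖x‖ ^ 2) :=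
    differentiableAt_id.mul ((radialBump.contDiff (n := 1)).differentiable (by simp) _)
  refine ⟨deriv (fun t => t * radialBump t) (‖x‖ ^ 2) * 2, ?_⟩
  rw [mul_smul, ofNat_smul_eq_nsmul]
  exact (hprofile.hasDerivAt.comp_hasFDerivAt x hsq).fderiv

theorem sum_inner_mul_fderiv_radialExt (g : TestFun m) {ι : Type*} [Fintype ι]
    (b : OrthonormalBasis ι ℝ (Ambient m)) {x : Ambient m} (hx : x ≠ 0) :
    ∑ i, (inner ℝ x (b i) : ℂ) * fderiv ℝ (radialExt g) x (b i) = 0 := by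
  rw [← fderiv_radialExt_self g hx]
  conv_rhs => rw [← b.sum_repr' x, map_sum]
  refine Finset.sum_congr rfl fun i _ => ?_
  rw [b.sum_repr', map_smul, Complex.real_smul, real_inner_comm]

/- The gradient of the radial factor is orthogonal to that of a radial extension, so the product
rule leaves a single term, symmetric in `f` and `g`. -/
theorem sum_fderiv_cutoff_mul (f g : TestFun m) {ι : Type*} [Fintype ι]
    (b : OrthonormalBasis ι ℝ (Ambient m)) (x : Ambient m) :
    ∑ i, fderiv ℝ (fun x => (cutoff x : ℂ) * radialExt f x) x (b i) *
        fderiv ℝ (radialExt g) x (b i) =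
      cutoff x * ∑ i, fderiv ℝ (radialExt f) x (b i) * fderiv ℝ (radialExt g) x (b i) := by
  rcases eq_or_ne x 0 with rfl | hx
  · have hzero : (fun x : Ambient m => (cutoff x : ℂ) * radialExt f x) =ᶠ[𝓝 0] fun _ => 0 := by
      filter_upwards [eventually_cutoff_eq_zero] with x hx
      simp [hx]
    simp only [hzero.fderiv_eq]
    simp [cutoff]
  obtain ⟨c, hc⟩ := exists_fderiv_cutoff_eq x
  have hcut : HasFDerivAt (fun x : Ambient m => (cutoff x : ℂ))
      (Complex.ofRealCLM.comp (c • innerSL ℝ x)) x :=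
    hc ▸ Complex.ofRealCLM.hasFDerivAt.comp x
      (contDiff_cutoff.differentiable (by simp) x).hasFDerivAt
  have hext := ((f.contDiffAt_two_radialExt hx).differentiableAt (by simp)).hasFDerivAt
  have hprod : ∀ i, fderiv ℝ (fun x => (cutoff x : ℂ) * radialExt f x) x (b i) =
      cutoff x * fderiv ℝ (radialExt f) x (b i) + radialExt f x * (c * (inner ℝ x (b i) : ℝ)) := by
    intro i
    rw [(hcut.fun_mul hext).fderiv]
    simp
  calc _ = cutoff x * ∑ i, fderiv ℝ (radialExt f) x (b i) * fderiv ℝ (radialExt g) x (b i) +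
        radialExt f x * c *
          ∑ i, (inner ℝ x (b i) : ℂ) * fderiv ℝ (radialExt g) x (b i) := by
        simp only [hprod, Finset.mul_sum, ← Finset.sum_add_distrib]
        exact Finset.sum_congr rfl fun i _ => by ring
    _ = _ := by rw [sum_inner_mul_fderiv_radialExt g b hx, mul_zero, add_zero]

theorem integral_cutoff_mul_laplacian (f g : TestFun m) :
    ∫ x, ((cutoff x : ℂ) * radialExt f x) *
        (Laplacian.laplacian (radialExt g) : Ambient m → ℂ) x =
      (∫ r, f r * laplaceBeltrami g r ∂(surface m)) *
        ∫ y : Set.Ioi (0 : ℝ), (radialBump ((y : ℝ) ^ 2) : ℂ) ∂(Measure.volumeIoiPow m) := by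
  rw [← integral_norm_mul_radialExt fun y => (radialBump (y ^ 2) : ℂ)]
  refine integral_congr_ae (ae_of_all _ fun x => ?_)
  rcases eq_or_ne x 0 with rfl | hx
  · simp
  · have hn : (‖x‖ : ℂ) ≠ 0 := by simpa using hx
    simp only [laplacian_radialExt g hx, radialExt_of_ne _ hx, cutoff]
    push_cast
    field_simp

theorem integral_radialBump_sq_ne_zero :
    ∫ y : Set.Ioi (0 : ℝ), (radialBump ((y : ℝ) ^ 2) : ℂ) ∂(Measure.volumeIoiPow m) ≠ 0 := by
  let w : Ambient m → ℝ := fun x => radialBump (‖x‖ ^ 2)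
  let x₀ : Ambient m := EuclideanSpace.single 0 (3 / 2)
  have hwc : Continuous w := radialBump.continuous.comp (by fun_prop)
  have hwx₀ : w x₀ = 1 := by
    refine radialBump.one_of_mem_closedBall ?_
    simp only [x₀, PiLp.norm_single, radialBump, Metric.mem_closedBall, Real.dist_eq]
    norm_num [abs_le]
  have hpos : 0 < ∫ x, w x :=
    hwc.integral_pos_of_hasCompactSupport_nonneg_nonzero hasCompactSupport_radialBump_norm_sq
      (fun x => radialBump.nonneg) (hwx₀.trans_ne one_ne_zero)
  have hpolar := integral_norm_mul_radialExt (m := m)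
    (fun y => (radialBump (y ^ 2) : ℂ)) (fun _ => 1)
  have hw : ∀ x : Ambient m, (radialBump (‖x‖ ^ 2) : ℂ) * radialExt (fun _ => 1) x = w x := by
    intro x
    rcases eq_or_ne x 0 with rfl | hx
    · simp [w, radialBump_norm_sq_eq_zero]
    · simp [w, radialExt_of_ne _ hx]
  intro hzero
  rw [hzero, mul_zero] at hpolar
  simp_rw [hw] at hpolar
  rw [integral_complex_ofReal, Complex.ofReal_eq_zero] at hpolar
  exact hpos.ne' hpolar

theorem integral_mul_laplaceBeltrami (f g : TestFun m) :
    ∫ r, f r * laplaceBeltrami g r ∂(surface m) = ∫ r, laplaceBeltrami f r * g r ∂(surface m) := by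
  have hgreen : ∀ f g : TestFun m, ∫ x, ((cutoff x : ℂ) * radialExt f x) *
        (Laplacian.laplacian (radialExt g) : Ambient m → ℂ) x =
      -∫ x, (cutoff x : ℂ) * ∑ i, fderiv ℝ (radialExt f) x (stdOrthonormalBasis ℝ (Ambient m) i) *
          fderiv ℝ (radialExt g) x (stdOrthonormalBasis ℝ (Ambient m) i) := fun f g => by
    simp_rw [← sum_fderiv_cutoff_mul]
    exact integral_mul_laplacian_eq_neg_integral_sum_fderiv
      ((contDiff_cutoff_mul_radialExt f).of_le (by norm_cast)) (hasCompactSupport_cutoff_mul _)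
      (fun x hx => g.contDiffAt_two_radialExt (ne_zero_of_mem_tsupport_cutoff_mul hx)) _
  have hsymm : ∫ r, f r * laplaceBeltrami g r ∂(surface m) =
      ∫ r, g r * laplaceBeltrami f r ∂(surface m) := by
    refine mul_right_cancel₀ (integral_radialBump_sq_ne_zero (m := m)) ?_
    rw [← integral_cutoff_mul_laplacian, ← integral_cutoff_mul_laplacian, hgreen, hgreen]
    refine congrArg Neg.neg (integral_congr_ae (ae_of_all _ fun x => ?_))
    exact congrArg _ (Finset.sum_congr rfl fun i _ => mul_comm _ _)
  exact hsymm.trans (integral_congr_ae (ae_of_all _ fun r => mul_comm _ _))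

/-! ### Ultraspherical polynomials and zonal functions -/

open Polynomial

/-- The ultraspherical function `ultraspherical m n` as an element of `ℝ[X]`, so that it can be
differentiated formally. -/
def ultraPoly (m : ℕ) : ℕ → ℝ[X]
  | 0 => 1
  | 1 => X
  | n + 2 => C ((n + m : ℝ)⁻¹) * ((2 * n + m + 1 : ℝ[X]) * X * ultraPoly m (n + 1)
      - (n + 1 : ℝ[X]) * ultraPoly m n)

theorem eval_ultraPoly (t : ℝ) : ∀ n, (ultraPoly m n).eval t = ultraspherical m n t
  | 0 => by simp [ultraPoly, ultraspherical]
  | 1 => by simp [ultraPoly, ultraspherical]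
  | n + 2 => by
    rw [ultraPoly, ultraspherical, ← eval_ultraPoly t (n + 1), ← eval_ultraPoly t n]
    simp [div_eq_inv_mul]

theorem ultraPoly_add_two (hm : 1 ≤ m) (n : ℕ) :
    (n + m : ℝ[X]) * ultraPoly m (n + 2) =
      (2 * n + m + 1 : ℝ[X]) * X * ultraPoly m (n + 1) - (n + 1 : ℝ[X]) * ultraPoly m n := by
  have hinv : (n + m : ℝ[X]) * C ((n + m : ℝ)⁻¹) = 1 := by
    have hne : (n + m : ℝ) ≠ 0 := by positivity
    have hC : (n + m : ℝ[X]) = C (n + m : ℝ) := by simp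
    rw [hC, ← C_mul, mul_inv_cancel₀ hne, C_1]
  rw [ultraPoly, ← mul_assoc, hinv, one_mul]

theorem ultraPoly_ladder (hm : 1 ≤ m) (n : ℕ) :
    (1 - X ^ 2) * derivative (ultraPoly m (n + 1)) =
        (n + 1 : ℝ[X]) * (ultraPoly m n - X * ultraPoly m (n + 1)) ∧
      (1 - X ^ 2) * derivative (ultraPoly m n) =
        (n + m - 1 : ℝ[X]) * (X * ultraPoly m n - ultraPoly m (n + 1)) := by
  induction n with
  | zero => simp [ultraPoly, sq]
  | succ n ih =>
    obtain ⟨lower, raise⟩ := ih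
    have hrec := ultraPoly_add_two hm n
    have hrec' := congrArg derivative hrec
    simp only [derivative_mul, derivative_add, derivative_sub, derivative_natCast, derivative_X,
      derivative_one, derivative_ofNat, zero_mul, mul_one, zero_add, add_zero, mul_zero] at hrec'
    constructor
    · have hne : (n + m : ℝ[X]) ≠ 0 := by
        rw [← Nat.cast_add, Nat.cast_ne_zero]
        omega
      apply mul_left_cancel₀ hne
      push_cast
      linear_combination (1 - X ^ 2) * hrec' + (2 * n + m + 1) * X * lower - (n + 1) * raise
        + (n + 2) * X * hrec
    · push_cast
      linear_combination lower + hrec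

theorem ultraPoly_ode (hm : 1 ≤ m) (n : ℕ) :
    (1 - X ^ 2) * derivative (derivative (ultraPoly m n)) -
        (m : ℝ[X]) * X * derivative (ultraPoly m n) =
      - (n * (n + m - 1) : ℝ[X]) * ultraPoly m n := by
  cases n with
  | zero => simp [ultraPoly]
  | succ n =>
    obtain ⟨lower, raise⟩ := ultraPoly_ladder hm n
    have lower' := congrArg derivative lower
    simp only [derivative_mul, derivative_add, derivative_sub, derivative_natCast, derivative_X,
      derivative_one, zero_mul, zero_add, derivative_X_pow, one_mul] at lower'
    have hne : (1 - X ^ 2 : ℝ[X]) ≠ 0 := fun h => by simpa using congrArg (eval 0) h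
    apply mul_left_cancel₀ hne
    push_cast at lower' ⊢
    simp only [map_ofNat, pow_one] at lower'
    linear_combination (1 - X ^ 2) * lower' + (n + 1) * raise - (n + m - 1) * X * lower

/-- The zonal function `r ↦ p(⟨r, s⟩)` with polynomial profile `p` and axis `s`. -/
def zonal (p : ℝ[X]) (s : Sphere m) : TestFun m :=
  ⟨fun r => ((p.eval (inner ℝ (r : Ambient m) (s : Ambient m)) : ℝ) : ℂ), by
    have hsmooth : ContDiff ℝ ∞ fun x : Ambient m =>
        ((p.eval (inner ℝ x (s : Ambient m)) : ℝ) : ℂ) :=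
      Complex.ofRealCLM.contDiff.comp
        ((contDiff_aeval p ∞).comp (contDiff_id.inner ℝ contDiff_const))
    have : Fact (Module.finrank ℝ (Ambient m) = m + 1) := ⟨finrank_euclideanSpace_fin⟩
    exact hsmooth.contMDiff.comp (contMDiff_coe_sphere (n := m))⟩

theorem zonal_apply (p : ℝ[X]) (s r : Sphere m) :
    zonal p s r = ((p.eval (inner ℝ (r : Ambient m) (s : Ambient m)) : ℝ) : ℂ) := rfl

theorem radialExt_zonal (p : ℝ[X]) (s : Sphere m) {x : Ambient m} (hx : x ≠ 0) :
    radialExt (zonal p s) x = ((p.eval (inner ℝ x (s : Ambient m) / ‖x‖) : ℝ) : ℂ) := by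
  rw [radialExt_of_ne _ hx, zonal_apply, TestFun.normalize, real_inner_smul_left, inv_mul_eq_div]

theorem hasDerivAt_one_add_mul_add_sq (c t : ℝ) :
    HasDerivAt (fun t => 1 + 2 * c * t + t ^ 2) (2 * c + 2 * t) t := by
  simpa using (((hasDerivAt_id t).const_mul (2 * c)).const_add 1).fun_add
    ((hasDerivAt_id t).fun_pow 2)

theorem hasDerivAt_add_mul_const (a b t : ℝ) : HasDerivAt (fun t => a + t * b) b t := by
  simpa using ((hasDerivAt_id t).mul_const b).const_add a

theorem hasDerivAt_div_sqrt (a b : ℝ) {c t : ℝ} (ht : 0 < 1 + 2 * c * t + t ^ 2) :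
    HasDerivAt (fun t => (a + t * b) / √(1 + 2 * c * t + t ^ 2))
      (b / √(1 + 2 * c * t + t ^ 2) - (a + t * b) * (c + t) / √(1 + 2 * c * t + t ^ 2) ^ 3) t := by
  have hsqrt := Real.sqrt_pos.mpr ht
  refine ((hasDerivAt_add_mul_const a b t).fun_div
    ((hasDerivAt_one_add_mul_add_sq c t).sqrt ht.ne') hsqrt.ne').congr_deriv ?_
  field_simp

theorem hasDerivAt_deriv_div_sqrt_zero (a b c : ℝ) :
    HasDerivAt (fun t => b / √(1 + 2 * c * t + t ^ 2) -
        (a + t * b) * (c + t) / √(1 + 2 * c * t + t ^ 2) ^ 3)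
      (3 * a * c ^ 2 - 2 * b * c - a) 0 := by
  have hsqrt : HasDerivAt (fun t : ℝ => √(1 + 2 * c * t + t ^ 2)) c 0 := by
    simpa using (hasDerivAt_one_add_mul_add_sq c 0).sqrt (by norm_num)
  have hnum : HasDerivAt (fun t : ℝ => (a + t * b) * (c + t)) (b * c + a) 0 := by
    simpa using (hasDerivAt_add_mul_const a b 0).fun_mul ((hasDerivAt_id (0 : ℝ)).const_add c)
  refine (((hasDerivAt_const (0 : ℝ) b).fun_div hsqrt (by simp)).fun_sub
    (hnum.fun_div (hsqrt.fun_pow 3) (by simp))).congr_deriv ?_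
  simp
  ring

theorem deriv_deriv_eval_div_sqrt (p : ℝ[X]) (a b c : ℝ) :
    deriv (deriv fun t : ℝ => ((p.eval ((a + t * b) / √(1 + 2 * c * t + t ^ 2)) : ℝ) : ℂ)) 0 =
      ((p.derivative.derivative.eval a * (b - a * c) ^ 2 +
        p.derivative.eval a * (3 * a * c ^ 2 - 2 * b * c - a) : ℝ) : ℂ) := by
  have hpos : ∀ᶠ t : ℝ in 𝓝 0, 0 < 1 + 2 * c * t + t ^ 2 :=
    (hasDerivAt_one_add_mul_add_sq c 0).continuousAt.eventually_const_lt (by norm_num)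
  have hderiv : (deriv fun t : ℝ =>
        ((p.eval ((a + t * b) / √(1 + 2 * c * t + t ^ 2)) : ℝ) : ℂ)) =ᶠ[𝓝 0]
      fun t => ((p.derivative.eval ((a + t * b) / √(1 + 2 * c * t + t ^ 2)) *
        (b / √(1 + 2 * c * t + t ^ 2) - (a + t * b) * (c + t) / √(1 + 2 * c * t + t ^ 2) ^ 3) :
          ℝ) : ℂ) := by
    filter_upwards [hpos] with t ht
    exact (((p.hasDerivAt _).comp t (hasDerivAt_div_sqrt a b ht)).ofReal_comp).deriv
  have hderiv₂ := ((p.derivative.hasDerivAt _).comp (0 : ℝ)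
    (hasDerivAt_div_sqrt a b (c := c) (t := 0) (by norm_num))).mul
    (hasDerivAt_deriv_div_sqrt_zero a b c)
  rw [hderiv.deriv_eq]
  refine hderiv₂.ofReal_comp.deriv.trans (congrArg _ ?_)
  simp
  ring

theorem inner_div_norm_line {E : Type*} [NormedAddCommGroup E] [InnerProductSpace ℝ E] {r v : E}
    (hr : ‖r‖ = 1) (hv : ‖v‖ = 1) (s : E) (t : ℝ) :
    inner ℝ (r + t • v) s / ‖r + t • v‖ =
      (inner ℝ r s + t * inner ℝ v s) / √(1 + 2 * inner ℝ r v * t + t ^ 2) := by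
  have hnorm : ‖r + t • v‖ ^ 2 = 1 + 2 * inner ℝ r v * t + t ^ 2 := by
    rw [norm_add_sq_real, hr, norm_smul, hv, real_inner_smul_right, Real.norm_eq_abs, mul_one,
      sq_abs]
    ring
  rw [← hnorm, Real.sqrt_sq (norm_nonneg _), inner_add_left, real_inner_smul_left]

theorem deriv_deriv_radialExt_zonal (p : ℝ[X]) (s r : Sphere m) {v : Ambient m} (hv : ‖v‖ = 1) :
    deriv (deriv fun t : ℝ => radialExt (zonal p s) ((r : Ambient m) + t • v)) 0 =
      ((p.derivative.derivative.eval (inner ℝ (r : Ambient m) (s : Ambient m)) *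
          (inner ℝ v (s : Ambient m) -
            inner ℝ (r : Ambient m) (s : Ambient m) * inner ℝ (r : Ambient m) v) ^ 2 +
        p.derivative.eval (inner ℝ (r : Ambient m) (s : Ambient m)) *
          (3 * inner ℝ (r : Ambient m) (s : Ambient m) * inner ℝ (r : Ambient m) v ^ 2
            - 2 * inner ℝ v (s : Ambient m) * inner ℝ (r : Ambient m) v
            - inner ℝ (r : Ambient m) (s : Ambient m)) : ℝ) : ℂ) := by
  rw [← deriv_deriv_eval_div_sqrt]
  refine EventuallyEq.deriv_eq (EventuallyEq.deriv ?_)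
  filter_upwards [(tendsto_line_zero (r : Ambient m) v).eventually_ne (sphere_ne_zero r)]
    with t hne
  rw [radialExt_zonal p s hne, inner_div_norm_line (norm_eq_of_mem_sphere r) hv]

theorem laplaceBeltrami_zonal (p : ℝ[X]) (s : Sphere m) :
    laplaceBeltrami (zonal p s) =
      zonal ((1 - X ^ 2) * derivative (derivative p) - (m : ℝ[X]) * X * derivative p) s := by
  ext r
  let b := stdOrthonormalBasis ℝ (Ambient m)
  rw [laplaceBeltrami_apply, laplacian_eq_sum_deriv_deriv
    ((zonal p s).contDiffAt_two_radialExt (sphere_ne_zero r)) b, zonal_apply]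
  simp_rw [deriv_deriv_radialExt_zonal p s r (b.norm_eq_one _)]
  rw [← Complex.ofReal_sum]
  congr 1
  set a : ℝ := inner ℝ (r : Ambient m) (s : Ambient m) with ha
  calc
    _ = p.derivative.derivative.eval a * ((∑ i, inner ℝ (b i) (s : Ambient m) ^ 2)
          - 2 * a * (∑ i, inner ℝ (r : Ambient m) (b i) * inner ℝ (b i) (s : Ambient m))
          + a ^ 2 * ∑ i, inner ℝ (r : Ambient m) (b i) ^ 2)
        + p.derivative.eval a * (3 * a * (∑ i, inner ℝ (r : Ambient m) (b i) ^ 2)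
          - 2 * (∑ i, inner ℝ (r : Ambient m) (b i) * inner ℝ (b i) (s : Ambient m))
          - a * ∑ _i : Fin (Module.finrank ℝ (Ambient m)), (1 : ℝ)) := by
      simp only [Finset.mul_sum, ← Finset.sum_sub_distrib, ← Finset.sum_add_distrib]
      exact Finset.sum_congr rfl fun i _ => by ring
    _ = _ := by
      rw [b.sum_sq_inner_right, b.sum_sq_inner_left, b.sum_inner_mul_inner, ← ha,
        norm_eq_of_mem_sphere, norm_eq_of_mem_sphere]
      simp
      ring

theorem zonal_ultraPoly_mem_Harm (hm : 1 ≤ m) (n : ℕ) (s : Sphere m) :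
    zonal (ultraPoly m n) s ∈ Harm m n := by
  rw [Harm, Module.End.mem_eigenspace_iff, laplaceBeltrami_zonal, ultraPoly_ode hm]
  ext r
  rw [smul_apply, zonal_apply, zonal_apply]
  simp

/-! ### Orthogonality of the eigenspaces -/

/-- Minus the eigenvalue of the Laplace-Beltrami operator on harmonics of order `n`. -/
def eig (m n : ℕ) : ℝ := n * (n + m - 1)

theorem mem_Harm_iff {n : ℕ} {h : TestFun m} :
    h ∈ Harm m n ↔ laplaceBeltrami h = (-(eig m n : ℂ)) • h := by
  rw [Harm, Module.End.mem_eigenspace_iff, eig]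
  push_cast
  rfl

theorem sq_le_eig (hm : 1 ≤ m) (n : ℕ) : (n : ℝ) ^ 2 ≤ eig m n := by
  have hm' : (1 : ℝ) ≤ m := by exact_mod_cast hm
  unfold eig
  nlinarith [(Nat.cast_nonneg n : (0 : ℝ) ≤ n)]

theorem eig_nonneg (hm : 1 ≤ m) (n : ℕ) : 0 ≤ eig m n := (sq_nonneg _).trans (sq_le_eig hm n)

theorem eig_strictMono (hm : 1 ≤ m) : StrictMono (eig m) := by
  refine strictMono_nat_of_lt_succ fun n => ?_
  have hm' : (1 : ℝ) ≤ m := by exact_mod_cast hm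
  unfold eig
  push_cast
  nlinarith [(Nat.cast_nonneg n : (0 : ℝ) ≤ n)]

theorem conjugate_mem_Harm {n : ℕ} {h : TestFun m} (hh : h ∈ Harm m n) :
    h.conjugate ∈ Harm m n := by
  rw [mem_Harm_iff] at hh ⊢
  rw [laplaceBeltrami_conjugate, hh]
  ext r
  simp only [conjugate_apply, smul_apply, map_mul, map_neg, Complex.conj_ofReal]

theorem compIsometry_mem_Harm {n : ℕ} {h : TestFun m} (hh : h ∈ Harm m n)
    (R : Ambient m ≃ₗᵢ[ℝ] Ambient m) : h.compIsometry R ∈ Harm m n := by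
  rw [mem_Harm_iff] at hh ⊢
  rw [laplaceBeltrami_compIsometry, hh]
  rfl

theorem integral_mul_eq_zero_of_ne (hm : 1 ≤ m) {n k : ℕ} (hnk : n ≠ k) {f g : TestFun m}
    (hf : f ∈ Harm m n) (hg : g ∈ Harm m k) : ∫ r, f r * g r ∂(surface m) = 0 := by
  have hsymm := integral_mul_laplaceBeltrami f g
  rw [mem_Harm_iff.mp hf, mem_Harm_iff.mp hg] at hsymm
  simp only [smul_apply, mul_left_comm _ (-(eig m k : ℂ)), mul_assoc, integral_const_mul] at hsymm
  have hne : ((eig m n : ℂ) - eig m k) ≠ 0 := by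
    rw [sub_ne_zero]
    exact_mod_cast (eig_strictMono hm).injective.ne hnk
  refine (mul_eq_zero.mp (?_ : ((eig m n : ℂ) - eig m k) * _ = 0)).resolve_left hne
  linear_combination hsymm

theorem l2inner_eq_zero_of_ne (hm : 1 ≤ m) {n k : ℕ} (hnk : n ≠ k) {f g : TestFun m}
    (hf : f ∈ Harm m n) (hg : g ∈ Harm m k) : l2inner f g = 0 :=
  integral_mul_eq_zero_of_ne hm hnk hf (conjugate_mem_Harm hg)

/-! ### Density of the spherical harmonics in the continuous functions -/

/-- Finite linear combinations of spherical harmonics. -/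
def harmonics (m : ℕ) : Submodule ℂ (TestFun m) := ⨆ n, Harm m n

theorem mem_harmonics_of_mem_Harm {n : ℕ} {h : TestFun m} (hh : h ∈ Harm m n) :
    h ∈ harmonics m :=
  Submodule.mem_iSup_of_mem n hh

theorem exists_eq_sum_range_of_mem_harmonics {h : TestFun m} (hh : h ∈ harmonics m) :
    ∃ (N : ℕ) (φ : ℕ → TestFun m), (∀ n, φ n ∈ Harm m n) ∧ h = ∑ n ∈ Finset.range N, φ n := by
  classical
  obtain ⟨f, hf, rfl⟩ := (Submodule.mem_iSup_iff_exists_finsupp _ _).mp hh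
  refine ⟨f.support.sup id + 1, f, hf, ?_⟩
  rw [Finsupp.sum]
  refine Finset.sum_subset (fun n hn => ?_) fun n _ hn => by simpa using hn
  rw [Finset.mem_range, Nat.lt_succ_iff]
  exact Finset.le_sup (f := id) hn

theorem X_mul_ultraPoly_succ (hm : 1 ≤ m) (n : ℕ) :
    X * ultraPoly m (n + 1) = (2 * n + m + 1 : ℝ)⁻¹ •
      ((n + m : ℝ) • ultraPoly m (n + 2) + (n + 1 : ℝ) • ultraPoly m n) := by
  have hne : (2 * n + m + 1 : ℝ) ≠ 0 := by positivity
  rw [eq_inv_smul_iff₀ hne]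
  simp only [smul_eq_C_mul, map_add, map_mul, map_natCast, map_one, map_ofNat]
  linear_combination -ultraPoly_add_two hm n

theorem span_ultraPoly_eq_top (hm : 1 ≤ m) :
    Submodule.span ℝ (Set.range (ultraPoly m)) = ⊤ := by
  set W := Submodule.span ℝ (Set.range (ultraPoly m))
  have hmem : ∀ n, ultraPoly m n ∈ W := fun n => Submodule.subset_span ⟨n, rfl⟩
  have hX : ∀ q ∈ W, X * q ∈ W := by
    intro q hq
    induction hq using Submodule.span_induction with
    | mem q hq =>
      obtain ⟨n, rfl⟩ := hq
      cases n with
      | zero => simpa [ultraPoly] using hmem 1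
      | succ n =>
        rw [X_mul_ultraPoly_succ hm]
        exact W.smul_mem _ (W.add_mem (W.smul_mem _ (hmem _)) (W.smul_mem _ (hmem _)))
    | zero => simp
    | add a b _ _ ha hb => rw [mul_add]; exact W.add_mem ha hb
    | smul c a _ ha => rw [mul_smul_comm]; exact W.smul_mem _ ha
  refine eq_top_iff.mpr fun p _ => ?_
  induction p using Polynomial.induction_on with
  | C a => simpa [ultraPoly, smul_eq_C_mul] using W.smul_mem a (hmem 0)
  | add p q hp hq => exact W.add_mem (hp trivial) (hq trivial)
  | monomial n a ih =>
    rw [pow_succ, ← mul_assoc, mul_comm]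
    exact hX _ (ih trivial)

theorem zonal_add (p q : ℝ[X]) (s : Sphere m) : zonal (p + q) s = zonal p s + zonal q s := by
  ext r
  rw [add_apply]
  simp only [zonal_apply, eval_add, Complex.ofReal_add]

theorem zonal_smul (c : ℝ) (p : ℝ[X]) (s : Sphere m) : zonal (c • p) s = (c : ℂ) • zonal p s := by
  ext r
  rw [smul_apply]
  simp only [zonal_apply, eval_smul, smul_eq_mul, Complex.ofReal_mul]

theorem zonal_zero (s : Sphere m) : zonal 0 s = 0 := by
  simpa using zonal_smul 0 0 s

theorem zonal_mem_harmonics (hm : 1 ≤ m) (p : ℝ[X]) (s : Sphere m) : zonal p s ∈ harmonics m := by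
  have hp : p ∈ Submodule.span ℝ (Set.range (ultraPoly m)) := by
    rw [span_ultraPoly_eq_top hm]
    trivial
  induction hp using Submodule.span_induction with
  | mem q hq =>
    obtain ⟨n, rfl⟩ := hq
    exact mem_harmonics_of_mem_Harm (zonal_ultraPoly_mem_Harm hm n s)
  | zero => rw [zonal_zero]; exact (harmonics m).zero_mem
  | add a b _ _ ha hb => rw [zonal_add]; exact (harmonics m).add_mem ha hb
  | smul c a _ ha => rw [zonal_smul]; exact (harmonics m).smul_mem _ ha

instance : Nonempty (Sphere m) := (NormedSpace.sphere_nonempty.mpr zero_le_one).to_subtype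

theorem exists_sphere_eq_norm_smul (y : Ambient m) : ∃ s : Sphere m, y = ‖y‖ • (s : Ambient m) := by
  rcases eq_or_ne y 0 with rfl | hy
  · exact ⟨Classical.arbitrary _, by simp⟩
  · exact ⟨normalize y hy, by rw [coe_normalize, smul_inv_smul₀ (norm_ne_zero_iff.mpr hy)]⟩

/-- The restriction to the sphere of the linear form `⟨·, y⟩`. -/
def linForm (m : ℕ) : Ambient m →ₗ[ℝ] C(Sphere m, ℝ) where
  toFun y := ⟨fun r => inner ℝ (r : Ambient m) y, by fun_prop⟩
  map_add' x y := by ext r; simp [inner_add_right]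
  map_smul' c y := by ext r; simp [real_inner_smul_right]

theorem linForm_apply (y : Ambient m) (r : Sphere m) :
    linForm m y r = inner ℝ (r : Ambient m) y := rfl

/-- The functions `exp ⟨·, y⟩` on the sphere. They are closed under multiplication and separate
points, so Stone-Weierstrass applies to their linear span. -/
def expForm (m : ℕ) : Multiplicative (Ambient m) →* C(Sphere m, ℝ) where
  toFun y := NormedSpace.exp (linForm m y.toAdd)
  map_one' := by simp
  map_mul' x y := by rw [toAdd_mul, map_add, NormedSpace.exp_add]

theorem expForm_apply (y : Ambient m) (r : Sphere m) :
    expForm m (Multiplicative.ofAdd y) r = Real.exp (inner ℝ (r : Ambient m) y) := by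
  rw [Real.exp_eq_exp_ℝ]
  exact NormedSpace.map_exp (ContinuousMap.evalAlgHom ℝ ℝ r)
    (ContinuousMap.evalCLM ℝ r).continuous (linForm m y)

theorem closure_span_range_expForm (m : ℕ) :
    closure (Submodule.span ℝ (Set.range (expForm m)) : Set C(Sphere m, ℝ)) = Set.univ := by
  have hsep : (Algebra.adjoin ℝ (Set.range (expForm m))).SeparatesPoints := by
    intro r s hrs
    refine ⟨_, ⟨expForm m (Multiplicative.ofAdd ((r : Ambient m) - (s : Ambient m))),
      Algebra.subset_adjoin ⟨_, rfl⟩, rfl⟩, ?_⟩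
    dsimp only
    rw [expForm_apply, expForm_apply, Ne, Real.exp_eq_exp, ← sub_eq_zero,
      ← inner_sub_left, inner_self_eq_zero, sub_eq_zero]
    exact fun h => hrs (Subtype.ext h)
  have hadjoin : (Algebra.adjoin ℝ (Set.range (expForm m)) : Set C(Sphere m, ℝ)) =
      Submodule.span ℝ (Set.range (expForm m)) := by
    have hspan := Algebra.adjoin_eq_span ℝ (Set.range (expForm m))
    rw [← MonoidHom.coe_mrange, Submonoid.closure_eq] at hspan
    rw [← MonoidHom.coe_mrange, ← hspan]
    rfl
  rw [← hadjoin, ← Subalgebra.topologicalClosure_coe,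
    ContinuousMap.subalgebra_topologicalClosure_eq_top_of_separatesPoints _ hsep]
  rfl

/-- The inclusion of real into complex continuous functions. -/
def ofRealCont (m : ℕ) : C(Sphere m, ℝ) →L[ℝ] C(Sphere m, ℂ) :=
  Complex.ofRealCLM.compLeftContinuous ℝ (Sphere m)

theorem ofRealCont_apply (g : C(Sphere m, ℝ)) (r : Sphere m) :
    ofRealCont m g r = (g r : ℂ) := rfl

/-- The uniform closure of the spherical harmonics in the continuous functions. -/
def harmonicsClosure (m : ℕ) : Submodule ℂ C(Sphere m, ℂ) :=
  ((harmonics m).map toContₗ).topologicalClosure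

theorem ofRealCont_linForm_pow_mem (hm : 1 ≤ m) (y : Ambient m) (k : ℕ) :
    ofRealCont m (linForm m y ^ k) ∈ harmonicsClosure m := by
  obtain ⟨s, hs⟩ := exists_sphere_eq_norm_smul y
  refine Submodule.le_topologicalClosure _
    ⟨zonal (‖y‖ ^ k • X ^ k) s, zonal_mem_harmonics hm _ _, ?_⟩
  ext r
  have hlin : linForm m y r = ‖y‖ * inner ℝ (r : Ambient m) (s : Ambient m) := by
    conv_lhs => rw [linForm_apply, hs, real_inner_smul_right]
  change zonal _ _ r = _
  rw [ofRealCont_apply, ContinuousMap.pow_apply, hlin, mul_pow, zonal_apply, eval_smul, eval_pow,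
    eval_X, smul_eq_mul]

theorem ofRealCont_mem_harmonicsClosure (hm : 1 ≤ m) (g : C(Sphere m, ℝ)) :
    ofRealCont m g ∈ harmonicsClosure m := by
  let K : Submodule ℝ C(Sphere m, ℝ) :=
    ((harmonicsClosure m).restrictScalars ℝ).comap (ofRealCont m : C(Sphere m, ℝ) →ₗ[ℝ] _)
  have hclosed : IsClosed (K : Set C(Sphere m, ℝ)) :=
    (Submodule.isClosed_topologicalClosure _).preimage (ofRealCont m).continuous
  have hexp : ∀ y, expForm m y ∈ K := fun y =>
    hclosed.mem_of_tendsto (NormedSpace.exp_series_hasSum_exp' (𝕂 := ℝ) (linForm m y.toAdd))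
      (Eventually.of_forall fun _ => K.sum_mem fun k _ =>
        K.smul_mem _ (ofRealCont_linForm_pow_mem hm _ k))
  have hspan : (Submodule.span ℝ (Set.range (expForm m)) : Set C(Sphere m, ℝ)) ⊆ K :=
    Submodule.span_le.mpr (Set.range_subset_iff.mpr hexp)
  have hall := closure_minimal hspan hclosed
  rw [closure_span_range_expForm] at hall
  exact hall (Set.mem_univ g)

theorem exists_mem_harmonics_norm_sub_lt (hm : 1 ≤ m) (g : C(Sphere m, ℂ)) {ε : ℝ} (hε : 0 < ε) :
    ∃ h ∈ harmonics m, ∀ r, ‖g r - h r‖ < ε := by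
  have hre_im : g = ofRealCont m ⟨fun r => (g r).re, by fun_prop⟩ +
      Complex.I • ofRealCont m ⟨fun r => (g r).im, by fun_prop⟩ := by
    ext r
    rw [ContinuousMap.add_apply, ContinuousMap.smul_apply, smul_eq_mul, mul_comm]
    exact (Complex.re_add_im (g r)).symm
  have hg : g ∈ harmonicsClosure m := by
    rw [hre_im]
    exact Submodule.add_mem _ (ofRealCont_mem_harmonicsClosure hm _)
      (Submodule.smul_mem _ _ (ofRealCont_mem_harmonicsClosure hm _))
  obtain ⟨_, ⟨h, hh, rfl⟩, hd⟩ := Metric.mem_closure_iff.mp hg ε hε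
  refine ⟨h, hh, fun r => ?_⟩
  rw [dist_eq_norm] at hd
  exact (ContinuousMap.norm_coe_le_norm (g - toContₗ h) r).trans_lt hd

/-! ### The `L²` inner product -/

instance (m : ℕ) : (surface m).IsOpenPosMeasure := by
  unfold surface; infer_instance

theorem area_pos (m : ℕ) : 0 < area m := by
  rw [area, Measure.real, ENNReal.toReal_pos_iff]
  exact ⟨isOpen_univ.measure_pos _ Set.univ_nonempty, measure_lt_top _ _⟩

theorem integrable_of_continuous {E : Type*} [NormedAddCommGroup E] {f : Sphere m → E}
    (hf : Continuous f) : Integrable f (surface m) :=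
  hf.integrable_of_hasCompactSupport (HasCompactSupport.of_compactSpace f)

theorem continuous_mul_conj (f g : TestFun m) : Continuous fun r => f r * starRingEnd ℂ (g r) :=
  f.continuous.mul (Complex.continuous_conj.comp g.continuous)

theorem l2inner_add_left (f g h : TestFun m) : l2inner (f + g) h = l2inner f h + l2inner g h := by
  simp only [l2inner, TestFun.add_apply, add_mul]
  exact integral_add (integrable_of_continuous (continuous_mul_conj f h))
    (integrable_of_continuous (continuous_mul_conj g h))

theorem l2inner_smul_left (c : ℂ) (f h : TestFun m) : l2inner (c • f) h = c * l2inner f h := by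
  simp only [l2inner, TestFun.smul_apply, mul_assoc, integral_const_mul]

theorem l2inner_conj (f g : TestFun m) : starRingEnd ℂ (l2inner f g) = l2inner g f := by
  rw [l2inner, ← integral_conj, l2inner]
  refine integral_congr_ae (ae_of_all _ fun r => ?_)
  simp [mul_comm]

/-- The inner product against a fixed function, as a linear form. -/
def l2left (h : TestFun m) : TestFun m →ₗ[ℂ] ℂ where
  toFun f := l2inner f h
  map_add' f g := l2inner_add_left f g h
  map_smul' c f := l2inner_smul_left c f h

theorem l2inner_sum_left {ι : Type*} (s : Finset ι) (f : ι → TestFun m) (h : TestFun m) :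
    l2inner (∑ i ∈ s, f i) h = ∑ i ∈ s, l2inner (f i) h := map_sum (l2left h) f s

theorem l2inner_sub_left (f g h : TestFun m) : l2inner (f - g) h = l2inner f h - l2inner g h :=
  map_sub (l2left h) f g

theorem l2inner_sum_right {ι : Type*} (s : Finset ι) (f : ι → TestFun m) (h : TestFun m) :
    l2inner h (∑ i ∈ s, f i) = ∑ i ∈ s, l2inner h (f i) := by
  rw [← l2inner_conj, l2inner_sum_left, map_sum]
  exact Finset.sum_congr rfl fun i _ => l2inner_conj _ _

theorem l2inner_smul_right (c : ℂ) (f h : TestFun m) :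
    l2inner f (c • h) = starRingEnd ℂ c * l2inner f h := by
  rw [← l2inner_conj, l2inner_smul_left, map_mul, l2inner_conj]

theorem l2inner_compIsometry (f g : TestFun m) (R : Ambient m ≃ₗᵢ[ℝ] Ambient m) :
    l2inner (f.compIsometry R) (g.compIsometry R) = l2inner f g := by
  have hmap := integral_map (μ := surface m) (φ := sphereMap R)
    (measurePreserving_sphereMap R).measurable.aemeasurable
    (continuous_mul_conj f g).aestronglyMeasurable
  rw [(measurePreserving_sphereMap R).map_eq] at hmap
  exact hmap.symm

theorem eq_zero_of_integral_mul_conj_eq_zero {f : Sphere m → ℂ} (hf : Continuous f)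
    (hzero : ∫ r, f r * starRingEnd ℂ (f r) ∂(surface m) = 0) : f = 0 := by
  have hsq : ∀ r, f r * starRingEnd ℂ (f r) = ((‖f r‖ ^ 2 : ℝ) : ℂ) := fun r => by
    rw [Complex.mul_conj, Complex.normSq_eq_norm_sq]
  simp_rw [hsq, integral_complex_ofReal, Complex.ofReal_eq_zero] at hzero
  have hcont : Continuous fun r => ‖f r‖ ^ 2 := by fun_prop
  have hae := (integral_eq_zero_iff_of_nonneg (fun r => by positivity)
    (integrable_of_continuous hcont)).mp hzero
  have heq := (hcont.ae_eq_iff_eq (surface m) continuous_const).mp hae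
  ext r
  have hr : ‖f r‖ ^ 2 = 0 := congrFun heq r
  simpa using hr

theorem eq_zero_of_l2inner_self_eq_zero {f : TestFun m} (h : l2inner f f = 0) : f = 0 :=
  TestFun.ext fun r => congrFun (eq_zero_of_integral_mul_conj_eq_zero f.continuous h) r

/-! ### Projections and reproducing kernels -/

theorem TestFun.sum_apply {ι : Type*} (s : Finset ι) (f : ι → TestFun m) (r : Sphere m) :
    (∑ i ∈ s, f i) r = ∑ i ∈ s, f i r := by
  classical
  induction s using Finset.induction_on with
  | empty => rfl
  | insert a s ha ih => rw [Finset.sum_insert ha, Finset.sum_insert ha, TestFun.add_apply, ih]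

namespace HarmonicBasis

variable (B : HarmonicBasis m)

theorem mem_Harm (n : ℕ) (k : Fin (harmDim m n)) : B.Y n k ∈ Harm m n := by
  rw [← B.span_eq]; exact Submodule.subset_span ⟨k, rfl⟩

theorem component_add (n : ℕ) (f g : TestFun m) :
    B.component n (f + g) = B.component n f + B.component n g := by
  simp only [component, l2inner_add_left, add_smul, Finset.sum_add_distrib]

theorem component_smul (n : ℕ) (c : ℂ) (f : TestFun m) :
    B.component n (c • f) = c • B.component n f := by
  simp only [component, l2inner_smul_left, mul_smul, Finset.smul_sum]

theorem component_mem (n : ℕ) (f : TestFun m) : B.component n f ∈ Harm m n :=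
  Submodule.sum_mem _ fun k _ => Submodule.smul_mem _ _ (B.mem_Harm n k)

theorem component_of_mem {n : ℕ} {f : TestFun m} (hf : f ∈ Harm m n) : B.component n f = f := by
  rw [← B.span_eq] at hf
  induction hf using Submodule.span_induction with
  | mem f hf =>
    obtain ⟨k, rfl⟩ := hf
    simp [component, B.orthonormal]
  | zero => simpa using B.component_smul n 0 0
  | add f g _ _ hf hg => rw [component_add, hf, hg]
  | smul c f _ hf => rw [component_smul, hf]

theorem component_of_mem_of_ne (hm : 1 ≤ m) {n k : ℕ} (hnk : n ≠ k) {f : TestFun m}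
    (hf : f ∈ Harm m n) : B.component k f = 0 := by
  refine Finset.sum_eq_zero fun i _ => ?_
  rw [l2inner_eq_zero_of_ne hm hnk hf (B.mem_Harm k i), zero_smul]

/-- The reproducing kernel of the space of harmonics of order `n`. -/
def kernel (n : ℕ) (s : Sphere m) : TestFun m := ∑ k, starRingEnd ℂ (B.Y n k s) • B.Y n k

theorem kernel_mem (n : ℕ) (s : Sphere m) : B.kernel n s ∈ Harm m n :=
  Submodule.sum_mem _ fun k _ => Submodule.smul_mem _ _ (B.mem_Harm n k)

theorem kernel_apply (n : ℕ) (s r : Sphere m) :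
    B.kernel n s r = ∑ k, starRingEnd ℂ (B.Y n k s) * B.Y n k r := by
  simp only [kernel, TestFun.sum_apply, TestFun.smul_apply]

theorem l2inner_kernel (n : ℕ) (s : Sphere m) (f : TestFun m) :
    l2inner f (B.kernel n s) = B.component n f s := by
  simp only [kernel, component, l2inner_sum_right, l2inner_smul_right, TestFun.sum_apply,
    TestFun.smul_apply, Complex.conj_conj, mul_comm]

theorem l2inner_kernel_of_mem {n : ℕ} (s : Sphere m) {f : TestFun m} (hf : f ∈ Harm m n) :
    l2inner f (B.kernel n s) = f s := by
  rw [l2inner_kernel, component_of_mem B hf]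

theorem kernel_conj (n : ℕ) (s r : Sphere m) :
    starRingEnd ℂ (B.kernel n s r) = B.kernel n r s := by
  rw [kernel_apply, kernel_apply, map_sum]
  refine Finset.sum_congr rfl fun k _ => ?_
  rw [map_mul, Complex.conj_conj, mul_comm]

/- Both sides reproduce the values at `s` of the harmonics of order `n`. -/
theorem kernel_sphereMap (n : ℕ) (R : Ambient m ≃ₗᵢ[ℝ] Ambient m) (s r : Sphere m) :
    B.kernel n (sphereMap R s) (sphereMap R r) = B.kernel n s r := by
  set k := (B.kernel n (sphereMap R s)).compIsometry R with hk
  have hsymm : ∀ q, sphereMap R.symm (sphereMap R q) = q := fun q => by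
    ext1; simp
  have hmem : k ∈ Harm m n := compIsometry_mem_Harm (B.kernel_mem n _) R
  have hrepr : ∀ f ∈ Harm m n, l2inner f k = f s := by
    intro f hf
    have hcomp : f = (f.compIsometry R.symm).compIsometry R := by
      ext q; simp [hsymm]
    rw [hcomp, hk, l2inner_compIsometry, l2inner_kernel_of_mem B _ (compIsometry_mem_Harm hf _),
      ← hcomp, compIsometry_apply, hsymm]
  have hkr : k r = starRingEnd ℂ (B.kernel n r s) := by
    rw [← hrepr _ (B.kernel_mem n r), l2inner_conj, l2inner_kernel_of_mem B _ hmem]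
  rw [kernel_conj] at hkr
  exact hkr

end HarmonicBasis

/-- The reflection exchanging two points of the sphere. -/
def swapReflection (r q : Sphere m) : Ambient m ≃ₗᵢ[ℝ] Ambient m :=
  (Submodule.span ℝ {(r : Ambient m) - (q : Ambient m)})ᗮ.reflection

theorem sphereMap_swapReflection_left (r q : Sphere m) : sphereMap (swapReflection r q) r = q :=
  Subtype.ext (Submodule.reflection_sub (by simp))

theorem sphereMap_swapReflection_of_inner_eq {r q s : Sphere m}
    (h : inner ℝ (r : Ambient m) (s : Ambient m) = inner ℝ (q : Ambient m) (s : Ambient m)) :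
    sphereMap (swapReflection r q) s = s := by
  refine Subtype.ext (Submodule.reflection_mem_subspace_eq_self ?_)
  rw [Submodule.mem_orthogonal_singleton_iff_inner_right, inner_sub_left, h, sub_self]

namespace HarmonicBasis

variable (B : HarmonicBasis m)

theorem kernel_eq_of_inner_eq (n : ℕ) {r q s : Sphere m}
    (h : inner ℝ (r : Ambient m) (s : Ambient m) = inner ℝ (q : Ambient m) (s : Ambient m)) :
    B.kernel n s r = B.kernel n s q := by
  rw [← B.kernel_sphereMap n (swapReflection r q) s r, sphereMap_swapReflection_left,
    sphereMap_swapReflection_of_inner_eq h]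

theorem kernel_self_eq_kernel_self (n : ℕ) (r q : Sphere m) : B.kernel n r r = B.kernel n q q := by
  rw [← B.kernel_sphereMap n (swapReflection r q), sphereMap_swapReflection_left]

theorem kernel_self (n : ℕ) (r : Sphere m) :
    B.kernel n r r = ((harmDim m n / area m : ℝ) : ℂ) := by
  have htrace : ∫ q, B.kernel n q q ∂(surface m) = harmDim m n := by
    simp only [kernel_apply, mul_comm (starRingEnd ℂ _)]
    rw [integral_finsetSum _ fun k _ => integrable_of_continuous (continuous_mul_conj _ _)]
    have hnorm : ∀ k, ∫ q, B.Y n k q * starRingEnd ℂ (B.Y n k q) ∂(surface m) = 1 := fun k =>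
      (B.orthonormal n k k).trans (if_pos rfl)
    simp [hnorm]
  simp_rw [B.kernel_self_eq_kernel_self n _ r] at htrace
  rw [integral_const, Complex.real_smul] at htrace
  have harea : (area m : ℂ) ≠ 0 := by exact_mod_cast (area_pos m).ne'
  push_cast
  rw [eq_div_iff harea, mul_comm]
  exact htrace

end HarmonicBasis

theorem exists_norm_eq_one_inner_eq_zero (hm : 1 ≤ m) (s : Sphere m) :
    ∃ e : Ambient m, ‖e‖ = 1 ∧ inner ℝ e (s : Ambient m) = 0 := by
  have : Fact (Module.finrank ℝ (Ambient m) = m + 1) := ⟨finrank_euclideanSpace_fin⟩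
  have hdim : Module.finrank ℝ (Submodule.span ℝ {(s : Ambient m)})ᗮ = m :=
    Submodule.finrank_orthogonal_span_singleton (sphere_ne_zero s)
  have hnontrivial : Nontrivial (Submodule.span ℝ {(s : Ambient m)})ᗮ :=
    Module.nontrivial_of_finrank_pos (R := ℝ) (by omega)
  obtain ⟨e, he⟩ := exists_norm_eq (Submodule.span ℝ {(s : Ambient m)})ᗮ (c := 1) zero_le_one
  refine ⟨e, by simpa using he, ?_⟩
  rw [real_inner_comm]
  exact Submodule.mem_orthogonal_singleton_iff_inner_right.mp e.2

theorem norm_smul_add_sqrt_smul {E : Type*} [NormedAddCommGroup E] [InnerProductSpace ℝ E]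
    {s e : E} (hs : ‖s‖ = 1) (he : ‖e‖ = 1) (hes : inner ℝ e s = 0) {t : ℝ}
    (ht : t ∈ Set.Icc (-1 : ℝ) 1) : ‖t • s + √(1 - t ^ 2) • e‖ = 1 := by
  have hnonneg : 0 ≤ 1 - t ^ 2 := by nlinarith [ht.1, ht.2]
  refine (sq_eq_sq₀ (norm_nonneg _) zero_le_one).mp ?_
  rw [norm_add_sq_real, norm_smul, norm_smul, hs, he, real_inner_smul_left,
    real_inner_smul_right, real_inner_comm, hes, mul_one, mul_one, Real.norm_eq_abs,
    Real.norm_eq_abs, sq_abs, sq_abs, Real.sq_sqrt hnonneg]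
  ring

theorem inner_mem_Icc (r s : Sphere m) :
    inner ℝ (r : Ambient m) (s : Ambient m) ∈ Set.Icc (-1 : ℝ) 1 := by
  have h := abs_real_inner_le_norm (r : Ambient m) (s : Ambient m)
  rw [norm_eq_of_mem_sphere, norm_eq_of_mem_sphere, mul_one] at h
  exact abs_le.mp h

theorem exists_profile (hm : 1 ≤ m) {d : TestFun m} {s : Sphere m}
    (hzonal : ∀ r q : Sphere m, inner ℝ (r : Ambient m) (s : Ambient m) =
      inner ℝ (q : Ambient m) (s : Ambient m) → d r = d q) :
    ∃ g : ℝ → ℂ, ContinuousOn g (Set.Icc (-1) 1) ∧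
      ∀ r : Sphere m, d r = g (inner ℝ (r : Ambient m) (s : Ambient m)) := by
  obtain ⟨e, he, hes⟩ := exists_norm_eq_one_inner_eq_zero hm s
  have hs : ‖(s : Ambient m)‖ = 1 := norm_eq_of_mem_sphere s
  let meridian : ℝ → Ambient m := fun t => t • (s : Ambient m) + √(1 - t ^ 2) • e
  have hnorm : ∀ t ∈ Set.Icc (-1 : ℝ) 1, ‖meridian t‖ = 1 := fun t ht =>
    norm_smul_add_sqrt_smul hs he hes ht
  have hcont : Continuous meridian := by fun_prop
  refine ⟨fun t => radialExt d (meridian t), fun t ht => ?_, fun r => ?_⟩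
  · have hne : meridian t ≠ 0 := fun h => by simpa [h] using hnorm t ht
    exact ((d.contDiffAt_two_radialExt hne).continuousAt.comp
      hcont.continuousAt).continuousWithinAt
  · set t : ℝ := inner ℝ (r : Ambient m) (s : Ambient m)
    let q : Sphere m := ⟨meridian t, mem_sphere_zero_iff_norm.mpr (hnorm t (inner_mem_Icc r s))⟩
    have hinner : inner ℝ (meridian t) (s : Ambient m) = t := by
      simp only [meridian]
      rw [inner_add_left, real_inner_smul_left, real_inner_smul_left, hes,
        real_inner_self_eq_norm_sq, hs]
      simp
    exact (hzonal r q hinner.symm).trans (radialExt_coe d q).symm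

theorem exists_zonal_near (hm : 1 ≤ m) {d : TestFun m} {s : Sphere m}
    (hzonal : ∀ r q : Sphere m, inner ℝ (r : Ambient m) (s : Ambient m) =
      inner ℝ (q : Ambient m) (s : Ambient m) → d r = d q) {ε : ℝ} (hε : 0 < ε) :
    ∃ p q : ℝ[X], ∀ r, ‖d r - (zonal p s + Complex.I • zonal q s) r‖ ≤ ε := by
  obtain ⟨g, hg, hd⟩ := exists_profile hm hzonal
  obtain ⟨p, hp⟩ := exists_polynomial_near_of_continuousOn (-1) 1 (fun t => (g t).re)
    (Complex.continuous_re.comp_continuousOn hg) (ε / 2) (half_pos hε)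
  obtain ⟨q, hq⟩ := exists_polynomial_near_of_continuousOn (-1) 1 (fun t => (g t).im)
    (Complex.continuous_im.comp_continuousOn hg) (ε / 2) (half_pos hε)
  refine ⟨p, q, fun r => ?_⟩
  have hr := inner_mem_Icc r s
  set t : ℝ := inner ℝ (r : Ambient m) (s : Ambient m) with ht
  have hsplit : d r - (zonal p s + Complex.I • zonal q s) r =
      (((g t).re - p.eval t : ℝ) : ℂ) + (((g t).im - q.eval t : ℝ) : ℂ) * Complex.I := by
    rw [TestFun.add_apply, TestFun.smul_apply, zonal_apply, zonal_apply, hd r, ← ht]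
    conv_lhs => rw [← Complex.re_add_im (g t)]
    push_cast
    ring
  rw [hsplit]
  refine (norm_add_le _ _).trans ?_
  rw [norm_mul, Complex.norm_I, mul_one, Complex.norm_real, Complex.norm_real,
    Real.norm_eq_abs, Real.norm_eq_abs, abs_sub_comm, abs_sub_comm (g t).im]
  linarith [hp t hr, hq t hr]

theorem eq_zero_of_forall_exists_near_orthogonal {d : TestFun m}
    (h : ∀ ε > 0, ∃ a : TestFun m, l2inner d a = 0 ∧ ∀ r, ‖d r - a r‖ ≤ ε) : d = 0 := by
  set I := ∫ r, ‖d r‖ ∂(surface m)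
  have hbound : ∀ ε : ℝ, 0 < ε → ‖l2inner d d‖ ≤ I * ε := by
    intro ε hε
    obtain ⟨a, horth, hnear⟩ := h ε hε
    have hdiff : l2inner d d = ∫ r, d r * starRingEnd ℂ (d r - a r) ∂(surface m) := by
      rw [← sub_zero (l2inner d d), ← horth, l2inner, l2inner,
        ← integral_sub (integrable_of_continuous (continuous_mul_conj _ _))
          (integrable_of_continuous (continuous_mul_conj _ _))]
      simp only [map_sub, mul_sub]
    rw [hdiff, ← integral_mul_const]
    refine norm_integral_le_of_norm_le
      ((integrable_of_continuous d.continuous.norm).mul_const _) (ae_of_all _ fun r => ?_)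
    rw [norm_mul, RCLike.norm_conj]
    exact mul_le_mul_of_nonneg_left (hnear r) (norm_nonneg _)
  have hlim : Tendsto (fun ε : ℝ => I * ε) (𝓝[>] 0) (𝓝 0) := by
    have hcont : Continuous fun ε : ℝ => I * ε := by fun_prop
    simpa using (hcont.tendsto 0).mono_left nhdsWithin_le_nhds
  exact eq_zero_of_l2inner_self_eq_zero
    (norm_le_zero_iff.mp (ge_of_tendsto hlim (eventually_mem_nhdsWithin.mono hbound)))

theorem eq_zero_of_zonal_of_forall_l2inner_zonal (hm : 1 ≤ m) {d : TestFun m} {s : Sphere m}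
    (hzonal : ∀ r q : Sphere m, inner ℝ (r : Ambient m) (s : Ambient m) =
      inner ℝ (q : Ambient m) (s : Ambient m) → d r = d q)
    (horth : ∀ p : ℝ[X], l2inner d (zonal p s) = 0) : d = 0 := by
  refine eq_zero_of_forall_exists_near_orthogonal fun ε hε => ?_
  obtain ⟨p, q, hpq⟩ := exists_zonal_near hm hzonal hε
  refine ⟨_, ?_, hpq⟩
  rw [← l2inner_conj, l2inner_add_left, l2inner_smul_left, ← l2inner_conj d, horth,
    ← l2inner_conj d, horth]
  simp

theorem l2inner_zonal_eq_zero (hm : 1 ≤ m) {d : TestFun m} {s : Sphere m}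
    (horth : ∀ n, l2inner d (zonal (ultraPoly m n) s) = 0) (p : ℝ[X]) :
    l2inner d (zonal p s) = 0 := by
  have hp : p ∈ Submodule.span ℝ (Set.range (ultraPoly m)) := by
    rw [span_ultraPoly_eq_top hm]
    trivial
  induction hp using Submodule.span_induction with
  | mem q hq =>
    obtain ⟨n, rfl⟩ := hq
    exact horth n
  | zero => simpa [zonal_zero] using l2inner_smul_right 0 d (0 : TestFun m)
  | add a b _ _ ha hb =>
    rw [zonal_add, ← l2inner_conj, l2inner_add_left, map_add, l2inner_conj, l2inner_conj, ha,
      hb, add_zero]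
  | smul t a _ ha => rw [zonal_smul, l2inner_smul_right, ha, mul_zero]

theorem eval_one_ultraPoly (hm : 1 ≤ m) : ∀ n, (ultraPoly m n).eval 1 = 1
  | 0 => by simp [ultraPoly]
  | 1 => by simp [ultraPoly]
  | n + 2 => by
    have hrec := congrArg (eval 1) (ultraPoly_add_two hm n)
    have hne : (n + m : ℝ) ≠ 0 := by positivity
    simp only [eval_mul, eval_add, eval_sub, eval_natCast, eval_X, eval_one, eval_ofNat,
      eval_one_ultraPoly hm (n + 1), eval_one_ultraPoly hm n] at hrec
    apply mul_left_cancel₀ hne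
    rw [hrec]
    ring

theorem zonal_ultraPoly_self (hm : 1 ≤ m) (n : ℕ) (s : Sphere m) :
    zonal (ultraPoly m n) s s = 1 := by
  rw [zonal_apply, real_inner_self_eq_norm_sq]
  simp [eval_one_ultraPoly hm]

namespace HarmonicBasis

variable (B : HarmonicBasis m)

theorem exists_kernel_eq_smul_zonal (hm : 1 ≤ m) (n : ℕ) (s : Sphere m) :
    ∃ c : ℂ, B.kernel n s = c • zonal (ultraPoly m n) s := by
  set P := zonal (ultraPoly m n) s with hP
  have hmem : P ∈ Harm m n := zonal_ultraPoly_mem_Harm hm n s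
  have hPs : P s = 1 := zonal_ultraPoly_self hm n s
  have hPP : l2inner P P ≠ 0 := fun h =>
    zero_ne_one ((congrArg (· s) (eq_zero_of_l2inner_self_eq_zero h)).symm.trans hPs)
  have hkernelP : l2inner (B.kernel n s) P = 1 := by
    rw [← l2inner_conj, B.l2inner_kernel_of_mem s hmem, hPs, map_one]
  refine ⟨(l2inner P P)⁻¹, sub_eq_zero.mp (eq_zero_of_zonal_of_forall_l2inner_zonal (s := s) hm
    (fun r q h => ?_) (l2inner_zonal_eq_zero hm fun k => ?_))⟩
  · change B.kernel n s r - _ * P r = B.kernel n s q - _ * P q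
    rw [B.kernel_eq_of_inner_eq n h, hP, zonal_apply, zonal_apply, h]
  · rcases eq_or_ne n k with rfl | hnk
    · rw [l2inner_sub_left, l2inner_smul_left, hkernelP, inv_mul_cancel₀ hPP, sub_self]
    · exact l2inner_eq_zero_of_ne hm hnk
        (Submodule.sub_mem _ (B.kernel_mem n s) (Submodule.smul_mem _ _ hmem))
        (zonal_ultraPoly_mem_Harm hm k s)

theorem kernel_eq_smul_zonal (hm : 1 ≤ m) (n : ℕ) (s : Sphere m) :
    B.kernel n s = ((harmDim m n / area m : ℝ) : ℂ) • zonal (ultraPoly m n) s := by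
  obtain ⟨c, hc⟩ := B.exists_kernel_eq_smul_zonal hm n s
  have hself := B.kernel_self n s
  rw [hc, TestFun.smul_apply, zonal_ultraPoly_self hm, mul_one] at hself
  rw [hc, hself]

theorem kernel_apply_eq_ultraspherical (hm : 1 ≤ m) (n : ℕ) (s r : Sphere m) :
    B.kernel n s r = ((harmDim m n / area m *
      ultraspherical m n (inner ℝ (r : Ambient m) (s : Ambient m)) : ℝ) : ℂ) := by
  rw [B.kernel_eq_smul_zonal hm, TestFun.smul_apply, zonal_apply, eval_ultraPoly,
    Complex.ofReal_mul]

theorem sum_norm_sq_eq (n : ℕ) (r : Sphere m) :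
    ∑ k, ‖B.Y n k r‖ ^ 2 = harmDim m n / area m := by
  have hself := B.kernel_self n r
  rw [kernel_apply] at hself
  simp_rw [mul_comm (starRingEnd ℂ _), Complex.mul_conj, Complex.normSq_eq_norm_sq] at hself
  exact_mod_cast hself

theorem norm_kernel_le (n : ℕ) (s r : Sphere m) :
    ‖B.kernel n s r‖ ≤ harmDim m n / area m := by
  have hamgm : ∀ k, ‖starRingEnd ℂ (B.Y n k s) * B.Y n k r‖ ≤
      (‖B.Y n k s‖ ^ 2 + ‖B.Y n k r‖ ^ 2) / 2 := fun k => by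
    rw [norm_mul, RCLike.norm_conj]
    nlinarith [sq_nonneg (‖B.Y n k s‖ - ‖B.Y n k r‖)]
  calc ‖B.kernel n s r‖ ≤ ∑ k, (‖B.Y n k s‖ ^ 2 + ‖B.Y n k r‖ ^ 2) / 2 := by
        rw [kernel_apply]
        exact norm_sum_le_of_le _ fun k _ => hamgm k
    _ = harmDim m n / area m := by
        rw [← Finset.sum_div, Finset.sum_add_distrib, sum_norm_sq_eq, sum_norm_sq_eq]
        ring

end HarmonicBasis

/-! ### Growth of the dimension of the spaces of harmonics -/

/-- Integration over the sphere of the zonal function with axis `s` and a polynomial profile, as a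
linear functional of the profile. -/
def zonalIntegral (s : Sphere m) : ℝ[X] →ₗ[ℝ] ℝ where
  toFun p := ∫ r : Sphere m, p.eval (inner ℝ (r : Ambient m) (s : Ambient m)) ∂(surface m)
  map_add' p q := by
    simp only [eval_add]
    exact integral_add (integrable_of_continuous (by fun_prop))
      (integrable_of_continuous (by fun_prop))
  map_smul' c p := by
    simp only [eval_smul, smul_eq_mul, integral_const_mul, RingHom.id_apply]

theorem zonalIntegral_natCast_mul (s : Sphere m) (c : ℕ) (p : ℝ[X]) :
    zonalIntegral s ((c : ℝ[X]) * p) = c * zonalIntegral s p := by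
  rw [← nsmul_eq_mul, map_nsmul, nsmul_eq_mul]

theorem ofReal_zonalIntegral_mul (s : Sphere m) (p q : ℝ[X]) :
    ((zonalIntegral s (p * q) : ℝ) : ℂ) = l2inner (zonal p s) (zonal q s) := by
  change ((∫ r : Sphere m, _ ∂(surface m) : ℝ) : ℂ) = _
  simp only [← integral_complex_ofReal, l2inner, zonal_apply, eval_mul, Complex.ofReal_mul,
    Complex.conj_ofReal]

theorem zonalIntegral_ultraPoly_of_ne (hm : 1 ≤ m) (s : Sphere m) {n k : ℕ} (h : n ≠ k) :
    zonalIntegral s (ultraPoly m n * ultraPoly m k) = 0 := by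
  rw [← Complex.ofReal_eq_zero, ofReal_zonalIntegral_mul,
    l2inner_eq_zero_of_ne hm h (zonal_ultraPoly_mem_Harm hm n s) (zonal_ultraPoly_mem_Harm hm k s)]

theorem HarmonicBasis.harmDim_mul_zonalIntegral (B : HarmonicBasis m) (hm : 1 ≤ m) (s : Sphere m)
    (n : ℕ) : (harmDim m n : ℝ) * zonalIntegral s (ultraPoly m n * ultraPoly m n) = area m := by
  have hreproducing := B.l2inner_kernel_of_mem s (zonal_ultraPoly_mem_Harm hm n s)
  rw [B.kernel_eq_smul_zonal hm, l2inner_smul_right, zonal_ultraPoly_self hm,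
    ← ofReal_zonalIntegral_mul, Complex.conj_ofReal] at hreproducing
  have hreal : harmDim m n / area m * zonalIntegral s (ultraPoly m n * ultraPoly m n) = 1 := by
    exact_mod_cast hreproducing
  rwa [div_mul_eq_mul_div, div_eq_one_iff_eq (area_pos m).ne'] at hreal

theorem add_mul_zonalIntegral_ultraPoly_add_two (hm : 1 ≤ m) (s : Sphere m) (n : ℕ) :
    (n + m : ℝ) * zonalIntegral s (ultraPoly m (n + 2) * ultraPoly m (n + 2)) =
      (2 * n + m + 1) * zonalIntegral s (X * ultraPoly m (n + 1) * ultraPoly m (n + 2)) := by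
  have hrec : ((n + m : ℕ) : ℝ[X]) * (ultraPoly m (n + 2) * ultraPoly m (n + 2)) =
      ((2 * n + m + 1 : ℕ) : ℝ[X]) * (X * ultraPoly m (n + 1) * ultraPoly m (n + 2)) -
        ((n + 1 : ℕ) : ℝ[X]) * (ultraPoly m n * ultraPoly m (n + 2)) := by
    push_cast
    linear_combination ultraPoly m (n + 2) * ultraPoly_add_two hm n
  have hint := congrArg (zonalIntegral s) hrec
  rw [map_sub, zonalIntegral_natCast_mul, zonalIntegral_natCast_mul, zonalIntegral_natCast_mul,
    zonalIntegral_ultraPoly_of_ne hm s (by omega : n ≠ n + 2), mul_zero, sub_zero] at hint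
  exact_mod_cast hint

theorem mul_zonalIntegral_X_mul_ultraPoly (hm : 1 ≤ m) (s : Sphere m) (n : ℕ) :
    (2 * n + m + 3 : ℝ) * zonalIntegral s (X * ultraPoly m (n + 1) * ultraPoly m (n + 2)) =
      (n + 2) * zonalIntegral s (ultraPoly m (n + 1) * ultraPoly m (n + 1)) := by
  have hrec : ((n + 1 + m : ℕ) : ℝ[X]) * (ultraPoly m (n + 3) * ultraPoly m (n + 1)) =
      ((2 * n + m + 3 : ℕ) : ℝ[X]) * (X * ultraPoly m (n + 1) * ultraPoly m (n + 2)) -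
        ((n + 2 : ℕ) : ℝ[X]) * (ultraPoly m (n + 1) * ultraPoly m (n + 1)) := by
    have := ultraPoly_add_two hm (n + 1)
    push_cast at this ⊢
    linear_combination ultraPoly m (n + 1) * this
  have hint := congrArg (zonalIntegral s) hrec
  rw [map_sub, zonalIntegral_natCast_mul, zonalIntegral_natCast_mul, zonalIntegral_natCast_mul,
    zonalIntegral_ultraPoly_of_ne hm s (by omega), mul_zero, eq_comm, sub_eq_zero] at hint
  exact_mod_cast hint

theorem HarmonicBasis.harmDim_recurrence (B : HarmonicBasis m) (hm : 1 ≤ m) (n : ℕ) :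
    (harmDim m (n + 2) : ℝ) * ((2 * n + m + 1) * (n + 2)) =
      harmDim m (n + 1) * ((n + m) * (2 * n + m + 3)) := by
  let s : Sphere m := Classical.arbitrary _
  have hnorm₁ := B.harmDim_mul_zonalIntegral hm s (n + 1)
  have hnorm₂ := B.harmDim_mul_zonalIntegral hm s (n + 2)
  have hmixed₁ := mul_zonalIntegral_X_mul_ultraPoly hm s n
  have hmixed₂ := add_mul_zonalIntegral_ultraPoly_add_two hm s n
  apply mul_left_cancel₀ (area_pos m).ne'
  linear_combination
    (-(harmDim m (n + 1) * harmDim m (n + 2)) : ℝ) *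
      ((2 * n + m + 3) * hmixed₂ + (2 * n + m + 1) * hmixed₁)
    + (harmDim m (n + 1) * ((n + m) * (2 * n + m + 3)) : ℝ) * hnorm₂
    - (harmDim m (n + 2) * ((2 * n + m + 1) * (n + 2)) : ℝ) * hnorm₁

theorem add_natCast_mul_pow_le {x : ℝ} (hx : 0 ≤ x) (k : ℕ) :
    (x + k) * x ^ k ≤ x * (x + 1) ^ k := by
  induction k with
  | zero => simp
  | succ k ih =>
    push_cast
    calc (x + (k + 1)) * x ^ (k + 1) ≤ (x + 1) * ((x + k) * x ^ k) := by
          rw [pow_succ]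
          nlinarith [mul_nonneg k.cast_nonneg (pow_nonneg hx k)]
      _ ≤ (x + 1) * (x * (x + 1) ^ k) := by gcongr
      _ = x * (x + 1) ^ (k + 1) := by ring

theorem mul_pow_sub_one_le_mul_pow_sub_one (hm : 1 ≤ m) (n : ℕ) :
    ((n + m) * (2 * n + m + 3) : ℝ) * (n + 1) ^ (m - 1) ≤
      ((2 * n + m + 1) * (n + 2)) * (n + 2) ^ (m - 1) := by
  obtain ⟨k, rfl⟩ := Nat.exists_eq_add_of_le' hm
  have hpow := add_natCast_mul_pow_le (by positivity : (0 : ℝ) ≤ n + 1) k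
  rw [show (n + 1 + 1 : ℝ) = n + 2 by ring] at hpow
  rw [Nat.add_sub_cancel]
  push_cast
  calc ((n + (k + 1)) * (2 * n + (k + 1) + 3) : ℝ) * (n + 1) ^ k
      = (2 * n + k + 4) * ((n + 1 + k) * (n + 1) ^ k) := by ring
    _ ≤ (2 * n + k + 4) * ((n + 1) * (n + 2) ^ k) := by gcongr
    _ = ((2 * n + k + 4) * (n + 1)) * (n + 2) ^ k := by ring
    _ ≤ ((2 * n + (k + 1) + 1) * (n + 2)) * (n + 2) ^ k := by
      gcongr ?_ * _
      nlinarith [(Nat.cast_nonneg k : (0 : ℝ) ≤ k)]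

theorem HarmonicBasis.harmDim_le (B : HarmonicBasis m) (hm : 1 ≤ m) (n : ℕ) :
    (harmDim m (n + 1) : ℝ) ≤ harmDim m 1 * (n + 1 : ℝ) ^ (m - 1) := by
  induction n with
  | zero => simp
  | succ n ih =>
    refine le_of_mul_le_mul_right ?_ (by positivity : (0 : ℝ) < (2 * n + m + 1) * (n + 2))
    calc (harmDim m (n + 2) : ℝ) * ((2 * n + m + 1) * (n + 2))
        = harmDim m (n + 1) * ((n + m) * (2 * n + m + 3)) := B.harmDim_recurrence hm n
      _ ≤ harmDim m 1 * (n + 1) ^ (m - 1) * ((n + m) * (2 * n + m + 3)) := by gcongr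
      _ = harmDim m 1 * ((n + m) * (2 * n + m + 3) * (n + 1) ^ (m - 1)) := by ring
      _ ≤ harmDim m 1 * ((2 * n + m + 1) * (n + 2) * (n + 2) ^ (m - 1)) := by
        gcongr _ * ?_
        exact mul_pow_sub_one_le_mul_pow_sub_one hm n
      _ = harmDim m 1 * ((n + 1 : ℕ) + 1 : ℝ) ^ (m - 1) * ((2 * n + m + 1) * (n + 2)) := by
        push_cast
        ring

theorem HarmonicBasis.harmDim_isBigO (B : HarmonicBasis m) (hm : 1 ≤ m) :
    (fun n => (harmDim m n : ℝ)) =O[atTop] fun n : ℕ => (n : ℝ) ^ (m - 1 : ℝ) := by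
  refine Asymptotics.IsBigO.of_bound (harmDim m 1) ?_
  filter_upwards [eventually_gt_atTop 0] with n hn
  obtain ⟨k, rfl⟩ := Nat.exists_eq_add_of_le' hn
  rw [Real.norm_of_nonneg (by positivity), Real.norm_of_nonneg (by positivity),
    show (m - 1 : ℝ) = ((m - 1 : ℕ) : ℝ) by rw [Nat.cast_sub hm, Nat.cast_one],
    Real.rpow_natCast]
  exact_mod_cast B.harmDim_le hm k

/-! ### Resolvents and uniqueness of generalised functions -/

/-- The operator `Id - ε Δ`. -/
def oneSubLaplace (m : ℕ) (ε : ℝ) : TestFun m →ₗ[ℂ] TestFun m :=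
  LinearMap.id - (ε : ℂ) • laplaceBeltrami

theorem oneSubLaplace_apply (ε : ℝ) (h : TestFun m) (r : Sphere m) :
    oneSubLaplace m ε h r = h r - ε * laplaceBeltrami h r := by
  have : oneSubLaplace m ε h = h + (-(ε : ℂ)) • laplaceBeltrami h := by
    simp [oneSubLaplace, sub_eq_add_neg]
  rw [sub_eq_add_neg, ← neg_mul, this]
  rfl

theorem oneSubLaplace_pow_of_mem_Harm {n : ℕ} {h : TestFun m} (hh : h ∈ Harm m n) (ε : ℝ)
    (K : ℕ) : (oneSubLaplace m ε ^ K) h = ((1 + ε * eig m n : ℝ) : ℂ) ^ K • h := by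
  induction K with
  | zero => simp
  | succ K ih =>
    have : oneSubLaplace m ε h = ((1 + ε * eig m n : ℝ) : ℂ) • h := by
      ext r
      rw [oneSubLaplace_apply, mem_Harm_iff.mp hh, smul_apply, smul_apply]
      push_cast
      ring
    rw [pow_succ', Module.End.mul_apply, ih, map_smul, this, smul_smul, ← pow_succ]

theorem norm_le_of_oneSubLaplace_pow {ε : ℝ} (hε : 0 ≤ ε) (K : ℕ) {h : TestFun m} {C : ℝ}
    (hC : ∀ r, ‖(oneSubLaplace m ε ^ K) h r‖ ≤ C) (r : Sphere m) : ‖h r‖ ≤ C := by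
  induction K generalizing h r with
  | zero => simpa using hC r
  | succ K ih =>
    refine norm_le_of_norm_sub_laplaceBeltrami_le h hε (fun q => ?_) r
    rw [← oneSubLaplace_apply]
    refine ih (fun q => ?_) q
    rw [← Module.End.mul_apply, ← pow_succ]
    exact hC q

/-- The multiplier of `(Id - ε Δ)^{-K}` on spherical harmonics of order `n`. -/
def resolventWeight (m : ℕ) (ε : ℝ) (K n : ℕ) : ℝ := ((1 + ε * eig m n) ^ K)⁻¹

theorem one_le_one_add_mul_eig (hm : 1 ≤ m) {ε : ℝ} (hε : 0 ≤ ε) (n : ℕ) :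
    1 ≤ 1 + ε * eig m n :=
  le_add_of_nonneg_right (mul_nonneg hε (eig_nonneg hm n))

theorem resolventWeight_pos (hm : 1 ≤ m) {ε : ℝ} (hε : 0 ≤ ε) (K n : ℕ) :
    0 < resolventWeight m ε K n :=
  inv_pos.mpr (pow_pos (one_pos.trans_le (one_le_one_add_mul_eig hm hε n)) K)

theorem resolventWeight_le_one (hm : 1 ≤ m) {ε : ℝ} (hε : 0 ≤ ε) (K n : ℕ) :
    resolventWeight m ε K n ≤ 1 :=
  inv_le_one_of_one_le₀ (one_le_pow₀ (one_le_one_add_mul_eig hm hε n))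

theorem antitone_resolventWeight (hm : 1 ≤ m) {ε : ℝ} (hε : 0 ≤ ε) (K : ℕ) :
    Antitone (resolventWeight m ε K) := fun n k hnk => by
  have hbase := one_le_one_add_mul_eig hm hε n
  have heig := (eig_strictMono hm).monotone hnk
  unfold resolventWeight
  gcongr

theorem tendsto_resolventWeight (m K n : ℕ) :
    Tendsto (fun ε => resolventWeight m ε K n) (𝓝 0) (𝓝 1) := by
  have : ContinuousAt (fun ε => resolventWeight m ε K n) 0 :=
    ContinuousAt.inv₀ (by fun_prop) (by simp)
  simpa [resolventWeight] using this.tendsto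

theorem resolventWeight_isBigO (hm : 1 ≤ m) {ε : ℝ} (hε : 0 < ε) (K : ℕ) :
    resolventWeight m ε K =O[atTop] fun n : ℕ => (n : ℝ) ^ (-(2 * K : ℝ)) := by
  refine Asymptotics.IsBigO.of_bound (ε ^ K)⁻¹ ?_
  filter_upwards [eventually_gt_atTop 0] with n hn
  have hn' : (0 : ℝ) < n := by exact_mod_cast hn
  have hbase : ε * (n : ℝ) ^ 2 ≤ 1 + ε * eig m n := by
    linarith [mul_le_mul_of_nonneg_left (sq_le_eig hm n) hε.le]
  have hpow : (n : ℝ) ^ (2 * K : ℝ) = ((n : ℝ) ^ 2) ^ K := by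
    rw [← pow_mul, ← Real.rpow_natCast, Nat.cast_mul, Nat.cast_ofNat]
  rw [Real.norm_of_nonneg (resolventWeight_pos hm hε.le K n).le,
    Real.norm_of_nonneg (by positivity), Real.rpow_neg hn'.le, ← mul_inv, hpow, ← mul_pow]
  unfold resolventWeight
  gcongr

/-- The operator `(Id - ε Δ)^{-K}` applied to the sum of the harmonics `φ n`, `n < N`. -/
def resolvent (ε : ℝ) (K N : ℕ) (φ : ℕ → TestFun m) : TestFun m :=
  ∑ n ∈ Finset.range N, (resolventWeight m ε K n : ℂ) • φ n

theorem resolvent_mem_harmonics {ε : ℝ} {K N : ℕ} {φ : ℕ → TestFun m}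
    (hφ : ∀ n, φ n ∈ Harm m n) : resolvent ε K N φ ∈ harmonics m :=
  Submodule.sum_mem _ fun n _ => Submodule.smul_mem _ _ (mem_harmonics_of_mem_Harm (hφ n))

theorem oneSubLaplace_pow_resolvent (hm : 1 ≤ m) {ε : ℝ} (hε : 0 ≤ ε) (K N : ℕ)
    {φ : ℕ → TestFun m} (hφ : ∀ n, φ n ∈ Harm m n) :
    (oneSubLaplace m ε ^ K) (resolvent ε K N φ) = ∑ n ∈ Finset.range N, φ n := by
  rw [resolvent, map_sum]
  refine Finset.sum_congr rfl fun n _ => ?_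
  have hne : (1 + ε * eig m n) ^ K ≠ 0 := (inv_pos.mp (resolventWeight_pos hm hε K n)).ne'
  rw [map_smul, oneSubLaplace_pow_of_mem_Harm (hφ n), smul_smul, resolventWeight,
    ← Complex.ofReal_pow, ← Complex.ofReal_mul, inv_mul_cancel₀ hne, Complex.ofReal_one, one_smul]

theorem norm_resolvent_le (hm : 1 ≤ m) {ε : ℝ} (hε : 0 ≤ ε) (K N : ℕ) {φ : ℕ → TestFun m}
    (hφ : ∀ n, φ n ∈ Harm m n) {C : ℝ} (hC : ∀ r, ‖(∑ n ∈ Finset.range N, φ n) r‖ ≤ C)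
    (r : Sphere m) : ‖resolvent ε K N φ r‖ ≤ C := by
  refine norm_le_of_oneSubLaplace_pow hε K (fun q => ?_) r
  rw [oneSubLaplace_pow_resolvent hm hε K N hφ]
  exact hC q

theorem seminormFamily_le {K : ℕ} {φ : TestFun m} {C : ℝ} (hC₀ : 0 ≤ C)
    (hC : ∀ r, ‖(oneSubLaplace m 1 ^ K) φ r‖ ≤ C) {k : ℕ} (hk : k ≤ K) :
    seminormFamily m k φ ≤ C := by
  have hone : (LinearMap.id - laplaceBeltrami : TestFun m →ₗ[ℂ] TestFun m) = oneSubLaplace m 1 := by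
    simp [oneSubLaplace]
  change ‖toContₗ (((LinearMap.id - laplaceBeltrami : TestFun m →ₗ[ℂ] TestFun m) ^ k) φ)‖ ≤ C
  rw [hone, ContinuousMap.norm_le _ hC₀]
  refine fun r => norm_le_of_oneSubLaplace_pow zero_le_one (K - k) (fun q => ?_) r
  rw [← Module.End.mul_apply, ← pow_add, Nat.sub_add_cancel hk]
  exact hC q

theorem dense_harmonics (hm : 1 ≤ m) : Dense (harmonics m : Set (TestFun m)) := by
  intro φ
  rw [mem_closure_iff_nhds]
  intro U hU
  obtain ⟨S, η, hη, hball⟩ := ((TestFun.withSeminorms m).mem_nhds_iff φ U).mp hU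
  set K := S.sup id
  obtain ⟨g, hg, hgn⟩ :=
    exists_mem_harmonics_norm_sub_lt hm (toContₗ ((oneSubLaplace m 1 ^ K) φ)) (half_pos hη)
  obtain ⟨N, ψ, hψ, rfl⟩ := exists_eq_sum_range_of_mem_harmonics hg
  have hnear : ∀ r, ‖(oneSubLaplace m 1 ^ K) (φ - resolvent 1 K N ψ) r‖ ≤ η / 2 := fun r => by
    rw [map_sub, oneSubLaplace_pow_resolvent hm zero_le_one K N hψ]
    exact (hgn r).le
  refine ⟨resolvent 1 K N ψ, hball ?_, resolvent_mem_harmonics hψ⟩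
  rw [Seminorm.mem_ball, ← neg_sub, map_neg_eq_map]
  refine (Seminorm.finset_sup_apply_le (half_pos hη).le fun k hk => ?_).trans_lt (half_lt_self hη)
  exact seminormFamily_le (half_pos hη).le hnear (Finset.le_sup (f := id) hk)

theorem genFun_ext (hm : 1 ≤ m) {u v : GenFun m} (h : ∀ n, ∀ φ ∈ Harm m n, u φ = v φ) :
    u = v := by
  refine DFunLike.coe_injective
    (Continuous.ext_on (dense_harmonics hm) u.continuous v.continuous fun φ hφ => ?_)
  obtain ⟨N, ψ, hψ, rfl⟩ := exists_eq_sum_range_of_mem_harmonics hφ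
  rw [map_sum, map_sum]
  exact Finset.sum_congr rfl fun n _ => h n _ (hψ n)

/-! ### Summation of series by monotone weights -/

/-- Abel's inequality. -/
theorem norm_sum_smul_le_of_antitone {E : Type*} [NormedAddCommGroup E] [NormedSpace ℝ E]
    {w : ℕ → ℝ} (hw : Antitone w) (hw₀ : ∀ n, 0 ≤ w n) {a : ℕ → E} {δ : ℝ}
    (ha : ∀ n, ‖∑ i ∈ Finset.range n, a i‖ ≤ δ) (n : ℕ) :
    ‖∑ i ∈ Finset.range n, w i • a i‖ ≤ w 0 * δ := by
  have hlast : ‖w (n - 1) • ∑ i ∈ Finset.range n, a i‖ ≤ w (n - 1) * δ := by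
    rw [norm_smul, Real.norm_of_nonneg (hw₀ _)]
    exact mul_le_mul_of_nonneg_left (ha n) (hw₀ _)
  have hparts :
      ‖∑ i ∈ Finset.range (n - 1), (w (i + 1) - w i) • ∑ j ∈ Finset.range (i + 1), a j‖ ≤
        ∑ i ∈ Finset.range (n - 1), (w i - w (i + 1)) * δ := by
    refine (norm_sum_le _ _).trans (Finset.sum_le_sum fun i _ => ?_)
    have hdiff := sub_nonneg.mpr (hw i.le_succ)
    rw [norm_smul, norm_sub_rev, Real.norm_of_nonneg hdiff]
    exact mul_le_mul_of_nonneg_left (ha _) hdiff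
  rw [← Finset.sum_mul, Finset.sum_range_sub'] at hparts
  rw [Finset.sum_range_by_parts]
  linarith [norm_sub_le (w (n - 1) • ∑ i ∈ Finset.range n, a i)
    (∑ i ∈ Finset.range (n - 1), (w (i + 1) - w i) • ∑ j ∈ Finset.range (i + 1), a j)]

theorem norm_tsum_smul_le_of_antitone {E : Type*} [NormedAddCommGroup E] [NormedSpace ℝ E]
    {w : ℕ → ℝ} (hw : Antitone w) (hw₀ : ∀ n, 0 ≤ w n) {a : ℕ → E} {δ : ℝ}
    (ha : ∀ n, ‖∑ i ∈ Finset.range n, a i‖ ≤ δ) (hs : Summable fun n => w n • a n) :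
    ‖∑' n, w n • a n‖ ≤ w 0 * δ :=
  le_of_tendsto hs.hasSum.tendsto_sum_nat.norm
    (Eventually.of_forall (norm_sum_smul_le_of_antitone hw hw₀ ha))

theorem norm_sum_range_add_le {E : Type*} [NormedAddCommGroup E] {a : ℕ → E} {A : E} {δ : ℝ}
    {M : ℕ} (hM : ∀ N ≥ M, ‖∑ n ∈ Finset.range N, a n - A‖ ≤ δ) (n : ℕ) :
    ‖∑ i ∈ Finset.range n, a (i + M)‖ ≤ 2 * δ := by
  have hsplit : ∑ i ∈ Finset.range n, a (i + M) =
      (∑ i ∈ Finset.range (M + n), a i - A) - (∑ i ∈ Finset.range M, a i - A) := by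
    rw [sub_sub_sub_cancel_right, Finset.sum_range_add, add_sub_cancel_left]
    simp only [add_comm]
  rw [hsplit, two_mul]
  exact (norm_sub_le _ _).trans (add_le_add (hM _ (by omega)) (hM _ le_rfl))

theorem tendsto_tsum_smul_of_antitone {E ι : Type*} [NormedAddCommGroup E] [NormedSpace ℝ E]
    {l : Filter ι} {a : ℕ → E} {A : E}
    (hA : Tendsto (fun N => ∑ n ∈ Finset.range N, a n) atTop (𝓝 A)) {w : ι → ℕ → ℝ}
    (hw : ∀ᶠ i in l, Antitone (w i)) (hw₀ : ∀ᶠ i in l, ∀ n, 0 ≤ w i n)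
    (hw₁ : ∀ᶠ i in l, ∀ n, w i n ≤ 1) (hlim : ∀ n, Tendsto (fun i => w i n) l (𝓝 1))
    (hs : ∀ᶠ i in l, Summable fun n => w i n • a n) :
    Tendsto (fun i => ∑' n, w i n • a n) l (𝓝 A) := by
  rw [Metric.tendsto_nhds]
  intro ε hε
  obtain ⟨M, hM⟩ := Metric.tendsto_atTop.mp hA (ε / 8) (by positivity)
  simp only [dist_eq_norm] at hM ⊢
  have htail := norm_sum_range_add_le fun N hN => (hM N hN).le
  have hhead : Tendsto (fun i => ∑ n ∈ Finset.range M, w i n • a n) l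
      (𝓝 (∑ n ∈ Finset.range M, a n)) :=
    tendsto_finsetSum _ fun n _ => by simpa using (hlim n).smul_const (a n)
  filter_upwards [hw, hw₀, hw₁, hs, Metric.tendsto_nhds.mp hhead (ε / 4) (by positivity)]
    with i hanti hnonneg hle hsum hclose
  rw [dist_eq_norm] at hclose
  have hrest : ‖∑' n, w i (n + M) • a (n + M)‖ ≤ ε / 4 := by
    refine (norm_tsum_smul_le_of_antitone (fun x y hxy => hanti (by omega)) (fun n => hnonneg _)
      htail ((summable_nat_add_iff M).mpr hsum)).trans ?_
    linarith [mul_le_mul_of_nonneg_right (hle (0 + M)) (by positivity : 0 ≤ 2 * (ε / 8))]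
  calc ‖∑' n, w i n • a n - A‖
      = ‖(∑ n ∈ Finset.range M, w i n • a n - ∑ n ∈ Finset.range M, a n) +
        (∑ n ∈ Finset.range M, a n - A) + ∑' n, w i (n + M) • a (n + M)‖ := by
        rw [← hsum.sum_add_tsum_nat_add M]
        congr 1
        abel
    _ ≤ _ := norm_add₃_le
    _ < ε := by linarith [hM M le_rfl]

/-! ### Duality with spherical harmonics -/

theorem integral_norm_sub_le_add {α E : Type*} [MeasurableSpace α] {μ : Measure α}
    [NormedAddCommGroup E] {f g h : α → E} (hf : Integrable f μ) (hg : Integrable g μ)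
    (hh : Integrable h μ) :
    ∫ x, ‖f x - h x‖ ∂μ ≤ ∫ x, ‖f x - g x‖ ∂μ + ∫ x, ‖g x - h x‖ ∂μ := by
  refine (integral_mono (hf.sub hh).norm ((hf.sub hg).norm.add (hg.sub hh).norm) fun x =>
    norm_sub_le_norm_sub_add_norm_sub _ _ _).trans_eq ?_
  exact integral_add (hf.sub hg).norm (hg.sub hh).norm

theorem integrable_mul_testFun {f : Sphere m → ℂ} (hf : Integrable f (surface m))
    (φ : TestFun m) : Integrable (fun r => f r * φ r) (surface m) :=
  hf.mul_bdd (c := ‖toContₗ φ‖) φ.continuous.aestronglyMeasurable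
    (ae_of_all _ (toContₗ φ).norm_coe_le_norm)

theorem norm_integral_mul_le {α : Type*} [MeasurableSpace α] {μ : Measure α} {f g : α → ℂ}
    (hf : Integrable f μ) {C : ℝ} (hC : ∀ x, ‖g x‖ ≤ C) :
    ‖∫ x, f x * g x ∂μ‖ ≤ (∫ x, ‖f x‖ ∂μ) * C := by
  rw [← integral_mul_const]
  refine norm_integral_le_of_norm_le (hf.norm.mul_const _) (ae_of_all _ fun x => ?_)
  rw [norm_mul]
  exact mul_le_mul_of_nonneg_left (hC x) (norm_nonneg _)

/-- The witness is `χ = conj G / (‖G‖ + δ)`, a continuous approximation of the sign of `conj G`. -/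
theorem exists_norm_le_one_integral_norm_sub_le {G : Sphere m → ℂ} (hG : Continuous G) {δ : ℝ}
    (hδ : 0 < δ) : ∃ χ : C(Sphere m, ℂ), (∀ r, ‖χ r‖ ≤ 1) ∧
      ∫ r, ‖G r‖ ∂(surface m) - area m * δ ≤ ‖∫ r, G r * χ r ∂(surface m)‖ := by
  have hpos : ∀ r, 0 < ‖G r‖ + δ := fun r => by positivity
  have hcont : Continuous fun r => starRingEnd ℂ (G r) / ((‖G r‖ + δ : ℝ) : ℂ) :=
    (Complex.continuous_conj.comp hG).div (by fun_prop) fun r => by exact_mod_cast (hpos r).ne'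
  have hint : Integrable (fun r => ‖G r‖) (surface m) := integrable_of_continuous hG.norm
  refine ⟨⟨_, hcont⟩, fun r => ?_, ?_⟩
  · rw [ContinuousMap.coe_mk, norm_div, RCLike.norm_conj, Complex.norm_real,
      Real.norm_of_nonneg (hpos r).le, div_le_one (hpos r)]
    linarith
  have hprod : ∀ r, G r * (starRingEnd ℂ (G r) / ((‖G r‖ + δ : ℝ) : ℂ)) =
      ((‖G r‖ ^ 2 / (‖G r‖ + δ) : ℝ) : ℂ) := fun r => by
    rw [← mul_div_assoc, Complex.mul_conj, Complex.normSq_eq_norm_sq]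
    push_cast
    rfl
  calc ∫ r, ‖G r‖ ∂(surface m) - area m * δ = ∫ r, (‖G r‖ - δ) ∂(surface m) := by
        rw [integral_sub hint (integrable_const _), integral_const, smul_eq_mul]
        rfl
    _ ≤ ∫ r, ‖G r‖ ^ 2 / (‖G r‖ + δ) ∂(surface m) := by
        refine integral_mono (hint.sub (integrable_const _)) (integrable_of_continuous
          (Continuous.div (by fun_prop) (by fun_prop) fun r => (hpos r).ne')) fun r => ?_
        simp only
        rw [le_div_iff₀ (hpos r)]
        nlinarith
    _ ≤ _ := by
        simp_rw [ContinuousMap.coe_mk, hprod]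
        rw [integral_complex_ofReal, Complex.norm_real]
        exact le_abs_self _

theorem integral_norm_le_of_forall_harmonics (hm : 1 ≤ m) {G : Sphere m → ℂ} (hG : Continuous G)
    {η : ℝ} (h : ∀ φ ∈ harmonics m, ∀ C : ℝ, (∀ r, ‖φ r‖ ≤ C) →
      ‖∫ r, G r * φ r ∂(surface m)‖ ≤ η * C) : ∫ r, ‖G r‖ ∂(surface m) ≤ η := by
  set I := ∫ r, ‖G r‖ ∂(surface m)
  have happrox : ∀ δ : ℝ, 0 < δ → I ≤ η * (1 + δ) + I * δ + area m * δ := by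
    intro δ hδ
    obtain ⟨χ, hχ, hGχ⟩ := exists_norm_le_one_integral_norm_sub_le hG hδ
    obtain ⟨φ, hφ, hnear⟩ := exists_mem_harmonics_norm_sub_lt hm χ hδ
    have hmain := h φ hφ (1 + δ) fun r => by
      have := norm_sub_norm_le (φ r) (χ r)
      rw [norm_sub_rev] at this
      linarith [hχ r, hnear r]
    have herror : ‖∫ r, G r * (χ r - φ r) ∂(surface m)‖ ≤ I * δ :=
      norm_integral_mul_le (integrable_of_continuous hG) fun r => (hnear r).le
    have hsplit : ∫ r, G r * χ r ∂(surface m) = ∫ r, G r * φ r ∂(surface m) +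
        ∫ r, G r * (χ r - φ r) ∂(surface m) := by
      rw [← integral_add (integrable_of_continuous (hG.fun_mul φ.continuous))
        (integrable_of_continuous (hG.fun_mul (χ.continuous.fun_sub φ.continuous)))]
      simp only [← mul_add, add_sub_cancel]
    rw [hsplit] at hGχ
    linarith [norm_add_le (∫ r, G r * φ r ∂(surface m)) (∫ r, G r * (χ r - φ r) ∂(surface m))]
  have hlim : Tendsto (fun δ : ℝ => η * (1 + δ) + I * δ + area m * δ) (𝓝[>] 0) (𝓝 η) := by
    have : Continuous fun δ : ℝ => η * (1 + δ) + I * δ + area m * δ := by fun_prop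
    simpa using (this.tendsto 0).mono_left nhdsWithin_le_nhds
  exact ge_of_tendsto hlim (eventually_mem_nhdsWithin.mono fun δ hδ => happrox δ hδ)

theorem integral_mul_sum {f : Sphere m → ℂ} (hf : Integrable f (surface m)) (N : ℕ)
    (ψ : ℕ → TestFun m) : ∫ r, f r * (∑ n ∈ Finset.range N, ψ n) r ∂(surface m) =
      ∑ n ∈ Finset.range N, ∫ r, f r * ψ n r ∂(surface m) := by
  simp only [TestFun.sum_apply, Finset.mul_sum]
  exact integral_finsetSum _ fun n _ => integrable_mul_testFun hf _

theorem eq_zero_of_forall_harmonics_integral_mul_eq_zero (hm : 1 ≤ m) {d : Sphere m → ℂ}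
    (hd : Continuous d) (h : ∀ n, ∀ φ ∈ Harm m n, ∫ r, d r * φ r ∂(surface m) = 0) : d = 0 := by
  have hnorm : ∫ r, ‖d r‖ ∂(surface m) ≤ 0 := by
    refine integral_norm_le_of_forall_harmonics hm hd fun φ hφ C _ => ?_
    obtain ⟨N, ψ, hψ, rfl⟩ := exists_eq_sum_range_of_mem_harmonics hφ
    rw [integral_mul_sum (integrable_of_continuous hd), Finset.sum_eq_zero fun n _ => h n _ (hψ n)]
    simp
  have hae := (integral_eq_zero_iff_of_nonneg (fun r => norm_nonneg _)
    (integrable_of_continuous hd.norm)).mp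
    (le_antisymm hnorm (integral_nonneg fun r => norm_nonneg (d r)))
  refine eq_zero_of_integral_mul_conj_eq_zero hd (integral_eq_zero_of_ae ?_)
  filter_upwards [hae] with r hr
  simp [norm_eq_zero.mp hr]

theorem exists_mem_harmonics_integral_norm_sub_le (hm : 1 ≤ m) {f : Sphere m → ℂ}
    (hf : Integrable f (surface m)) {η : ℝ} (hη : 0 < η) :
    ∃ g ∈ harmonics m, ∫ r, ‖f r - g r‖ ∂(surface m) ≤ η := by
  obtain ⟨c, hc, hci⟩ := hf.exists_boundedContinuous_integral_sub_le (half_pos hη)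
  obtain ⟨g, hg, hgn⟩ := exists_mem_harmonics_norm_sub_lt hm c.toContinuousMap
    (div_pos (half_pos hη) (area_pos m))
  refine ⟨g, hg, ?_⟩
  have hcg : ∫ r, ‖c r - g r‖ ∂(surface m) ≤ η / 2 := by
    refine (integral_mono (integrable_of_continuous (c.continuous.sub g.continuous).norm)
      (integrable_const (η / 2 / area m)) fun r => (hgn r).le).trans ?_
    rw [integral_const, smul_eq_mul]
    exact (mul_div_cancel₀ _ (area_pos m).ne').le
  linarith [integral_norm_sub_le_add hf hci (integrable_of_continuous g.continuous)]

theorem integral_resolvent_mul_sum (hm : 1 ≤ m) (ε : ℝ) (K N M : ℕ) {φ ψ : ℕ → TestFun m}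
    (hφ : ∀ n, φ n ∈ Harm m n) (hψ : ∀ n, ψ n ∈ Harm m n) :
    ∫ r, resolvent ε K N φ r * (∑ n ∈ Finset.range M, ψ n) r ∂(surface m) =
      ∫ r, (∑ n ∈ Finset.range N, φ n) r * resolvent ε K M ψ r ∂(surface m) := by
  have hint : ∀ f g : TestFun m, Integrable (fun r => f r * g r) (surface m) := fun f g =>
    integrable_of_continuous (f.continuous.mul g.continuous)
  simp only [resolvent, TestFun.sum_apply, Finset.sum_mul_sum]
  rw [integral_finsetSum _ fun n _ => integrable_finsetSum _ fun k _ => hint _ _,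
    integral_finsetSum _ fun n _ => integrable_finsetSum _ fun k _ => hint _ _]
  refine Finset.sum_congr rfl fun n _ => ?_
  rw [integral_finsetSum _ fun k _ => hint _ _, integral_finsetSum _ fun k _ => hint _ _]
  refine Finset.sum_congr rfl fun k _ => ?_
  rcases eq_or_ne n k with rfl | hnk
  · simp only [TestFun.smul_apply, mul_left_comm, mul_assoc]
  · rw [integral_mul_eq_zero_of_ne hm hnk (Submodule.smul_mem _ _ (hφ n)) (hψ k),
      integral_mul_eq_zero_of_ne hm hnk (hφ n) (Submodule.smul_mem _ _ (hψ k))]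

theorem integral_norm_resolvent_sub_le (ε : ℝ) (K N : ℕ) (φ : ℕ → TestFun m) :
    ∫ r, ‖resolvent ε K N φ r - (∑ n ∈ Finset.range N, φ n) r‖ ∂(surface m) ≤
      ∑ n ∈ Finset.range N, |resolventWeight m ε K n - 1| * ∫ r, ‖φ n r‖ ∂(surface m) := by
  have hint : ∀ n, Integrable (fun r => |resolventWeight m ε K n - 1| * ‖φ n r‖) (surface m) :=
    fun n => (integrable_of_continuous (φ n).continuous.norm).const_mul _
  simp_rw [← integral_const_mul]
  rw [← integral_finsetSum _ fun n _ => hint n]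
  refine integral_mono (integrable_of_continuous
    ((resolvent ε K N φ).continuous.sub (TestFun.continuous _)).norm)
    (integrable_finsetSum _ fun n _ => hint n) fun r => ?_
  simp only [resolvent, TestFun.sum_apply, ← Finset.sum_sub_distrib]
  refine (norm_sum_le _ _).trans (Finset.sum_le_sum fun n _ => ?_)
  rw [TestFun.smul_apply, ← sub_one_mul, norm_mul, ← Complex.ofReal_one, ← Complex.ofReal_sub,
    Complex.norm_real, Real.norm_eq_abs]

theorem tendsto_integral_norm_resolvent_sub (K N : ℕ) (φ : ℕ → TestFun m) :
    Tendsto (fun ε : ℝ => ∫ r, ‖resolvent ε K N φ r - (∑ n ∈ Finset.range N, φ n) r‖ ∂(surface m))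
      (𝓝 0) (𝓝 0) := by
  refine squeeze_zero (fun ε => integral_nonneg fun r => norm_nonneg _)
    (fun ε => integral_norm_resolvent_sub_le ε K N φ) ?_
  have hterm : ∀ n, Tendsto (fun ε => |resolventWeight m ε K n - 1| * ∫ r, ‖φ n r‖ ∂(surface m))
      (𝓝 0) (𝓝 0) := fun n => by
    simpa using ((tendsto_resolventWeight m K n).sub_const 1).abs.mul_const
      (∫ r, ‖φ n r‖ ∂(surface m))
  simpa using tendsto_finsetSum (Finset.range N) fun n _ => hterm n

/-! ### Fourier expansions of smooth functions -/

theorem hasSum_integral_mul {α : Type*} [MeasurableSpace α] {μ : Measure α} {g : ℕ → α → ℂ}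
    (hg : ∀ n, AEStronglyMeasurable (g n) μ) {u : ℕ → ℝ} (hu : Summable u)
    (hgu : ∀ n x, ‖g n x‖ ≤ u n) {h : α → ℂ} (hh : Integrable h μ) :
    HasSum (fun n => ∫ x, g n x * h x ∂μ) (∫ x, (∑' n, g n x) * h x ∂μ) := by
  have hint : ∀ n, Integrable (fun x => g n x * h x) μ := fun n =>
    hh.bdd_mul (hg n) (ae_of_all _ (hgu n))
  have hsum : Summable fun n => ∫ x, ‖g n x * h x‖ ∂μ := by
    refine Summable.of_nonneg_of_le (fun n => integral_nonneg fun x => norm_nonneg _) (fun n => ?_)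
      (hu.mul_right (∫ x, ‖h x‖ ∂μ))
    rw [← integral_const_mul]
    refine integral_mono (hint n).norm (hh.norm.const_mul _) fun x => ?_
    simp only [norm_mul]
    exact mul_le_mul_of_nonneg_right (hgu n x) (norm_nonneg _)
  simpa only [tsum_mul_right] using hasSum_integral_of_summable_integral_norm hint hsum

theorem l2inner_laplaceBeltrami {n : ℕ} {h : TestFun m} (hh : h ∈ Harm m n) (φ : TestFun m) :
    l2inner (laplaceBeltrami φ) h = -(eig m n : ℂ) * l2inner φ h := by
  have hsymm := integral_mul_laplaceBeltrami φ h.conjugate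
  rw [mem_Harm_iff.mp (conjugate_mem_Harm hh)] at hsymm
  simp only [TestFun.smul_apply, mul_left_comm _ (-(eig m n : ℂ)), integral_const_mul] at hsymm
  exact hsymm.symm

theorem l2inner_oneSubLaplace_pow {n : ℕ} {h : TestFun m} (hh : h ∈ Harm m n) (φ : TestFun m)
    (ε : ℝ) (K : ℕ) :
    l2inner ((oneSubLaplace m ε ^ K) φ) h = ((1 + ε * eig m n : ℝ) : ℂ) ^ K * l2inner φ h := by
  induction K generalizing φ with
  | zero => simp
  | succ K ih =>
    have hsub : oneSubLaplace m ε φ = φ - (ε : ℂ) • laplaceBeltrami φ := rfl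
    rw [pow_succ, Module.End.mul_apply, ih, hsub, l2inner_sub_left, l2inner_smul_left,
      l2inner_laplaceBeltrami hh]
    push_cast
    ring

theorem HarmonicBasis.summable_mul_harmDim (B : HarmonicBasis m) (hm : 1 ≤ m) {c : ℕ → ℝ}
    {a : ℝ} (hc : c =O[atTop] fun n : ℕ => (n : ℝ) ^ a) (ha : a + m < 0) :
    Summable fun n => |c n| * (harmDim m n / area m) := by
  have hmul : (fun n => |c n| * (harmDim m n / area m)) =O[atTop]
      fun n : ℕ => (n : ℝ) ^ a * (n : ℝ) ^ (m - 1 : ℝ) := by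
    refine hc.abs_left.mul ?_
    simp only [div_eq_inv_mul]
    exact (B.harmDim_isBigO hm).const_mul_left _
  refine summable_of_isBigO_nat (Real.summable_nat_rpow.mpr (by linarith : a + (m - 1) < -1))
    (hmul.congr' EventuallyEq.rfl ?_)
  filter_upwards [eventually_gt_atTop 0] with n hn
  rw [Real.rpow_add (by exact_mod_cast hn)]

namespace HarmonicBasis

variable (B : HarmonicBasis m)

theorem l2inner_component {n : ℕ} {h : TestFun m} (hh : h ∈ Harm m n) (φ : TestFun m) :
    l2inner (B.component n φ) h = l2inner φ h := by
  conv_rhs => rw [← B.component_of_mem hh]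
  simp only [component, l2inner_sum_left, l2inner_sum_right, l2inner_smul_left,
    l2inner_smul_right, l2inner_conj, mul_comm]

theorem norm_component_le (hm : 1 ≤ m) (φ : TestFun m) (K n : ℕ) (s : Sphere m) :
    ‖B.component n φ s‖ ≤ (∫ r, ‖(oneSubLaplace m 1 ^ K) φ r‖ ∂(surface m)) *
      (resolventWeight m 1 K n * (harmDim m n / area m)) := by
  have hpos := one_pos.trans_le (one_le_one_add_mul_eig hm zero_le_one n)
  have hbound : ‖l2inner ((oneSubLaplace m 1 ^ K) φ) (B.kernel n s)‖ ≤
      (∫ r, ‖(oneSubLaplace m 1 ^ K) φ r‖ ∂(surface m)) * (harmDim m n / area m) :=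
    norm_integral_mul_le (integrable_of_continuous (TestFun.continuous _)) fun r => by
      rw [RCLike.norm_conj]
      exact B.norm_kernel_le n s r
  rw [l2inner_oneSubLaplace_pow (B.kernel_mem n s), l2inner_kernel, norm_mul, norm_pow,
    Complex.norm_real, Real.norm_of_nonneg hpos.le] at hbound
  rw [resolventWeight, mul_left_comm, ← div_eq_inv_mul, le_div_iff₀ (by positivity), mul_comm]
  exact hbound

theorem exists_summable_norm_mul_component_le (hm : 1 ≤ m) {c : ℕ → ℝ} {a : ℝ}
    (hc : c =O[atTop] fun n : ℕ => (n : ℝ) ^ a) (φ : TestFun m) :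
    ∃ u : ℕ → ℝ, Summable u ∧ ∀ n r, ‖(c n : ℂ) * B.component n φ r‖ ≤ u n := by
  obtain ⟨K, hK⟩ := exists_nat_gt ((a + m) / 2)
  have hdecay : (fun n => c n * resolventWeight m 1 K n) =O[atTop]
      fun n : ℕ => (n : ℝ) ^ (a - 2 * K) := by
    refine (hc.mul (resolventWeight_isBigO hm one_pos K)).congr' EventuallyEq.rfl ?_
    filter_upwards [eventually_gt_atTop 0] with n hn
    rw [← Real.rpow_add (by exact_mod_cast hn), sub_eq_add_neg]
  refine ⟨_, (B.summable_mul_harmDim hm hdecay (by linarith)).mul_left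
    (∫ r, ‖(oneSubLaplace m 1 ^ K) φ r‖ ∂(surface m)), fun n r => ?_⟩
  rw [norm_mul, Complex.norm_real, Real.norm_eq_abs, abs_mul,
    abs_of_pos (resolventWeight_pos hm zero_le_one K n)]
  refine (mul_le_mul_of_nonneg_left (B.norm_component_le hm φ K n r) (abs_nonneg _)).trans_eq ?_
  ring

theorem tsum_component (hm : 1 ≤ m) (φ : TestFun m) (r : Sphere m) :
    ∑' n, B.component n φ r = φ r := by
  have hone : (fun _ : ℕ => (1 : ℝ)) =O[atTop] fun n : ℕ => (n : ℝ) ^ (0 : ℝ) := by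
    simpa using Asymptotics.isBigO_refl (fun _ : ℕ => (1 : ℝ)) atTop
  obtain ⟨u, hu, hle⟩ := B.exists_summable_norm_mul_component_le hm hone φ
  simp only [Complex.ofReal_one, one_mul] at hle
  have hcont : Continuous fun r => ∑' n, B.component n φ r :=
    continuous_tsum (fun n => (B.component n φ).continuous) hu hle
  have horth : ∀ n, ∀ h ∈ Harm m n,
      ∫ r, (∑' k, B.component k φ r - φ r) * h r ∂(surface m) = 0 := by
    intro n h hh
    have hseries := (hasSum_integral_mul (fun n =>
      (B.component n φ).continuous.aestronglyMeasurable) hu hle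
      (integrable_of_continuous h.continuous)).unique (hasSum_single n fun k hk =>
        integral_mul_eq_zero_of_ne hm hk (B.component_mem k φ) hh)
    have hcomp := B.l2inner_component (conjugate_mem_Harm hh) φ
    simp only [l2inner, conjugate_apply, Complex.conj_conj] at hcomp
    simp only [sub_mul]
    rw [integral_sub (integrable_of_continuous (hcont.fun_mul h.continuous))
      (integrable_of_continuous (φ.continuous.fun_mul h.continuous)), hseries, hcomp, sub_self]
  exact sub_eq_zero.mp (congrFun (eq_zero_of_forall_harmonics_integral_mul_eq_zero hm
    (hcont.sub φ.continuous) horth) r)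

theorem sum_integral_smul_conjugate {n : ℕ} {φ : TestFun m} (hφ : φ ∈ Harm m n) :
    ∑ k, (∫ r, B.Y n k r * φ r ∂(surface m)) • (B.Y n k).conjugate = φ := by
  ext r
  have hexp := congrArg (fun f : TestFun m => starRingEnd ℂ (f r))
    (B.component_of_mem (conjugate_mem_Harm hφ))
  simp only [component, TestFun.sum_apply, TestFun.smul_apply, conjugate_apply, map_sum, map_mul,
    l2inner_conj, Complex.conj_conj] at hexp
  rw [← hexp, TestFun.sum_apply]
  exact Finset.sum_congr rfl fun k _ => by simp [l2inner]

end HarmonicBasis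

/-! ### Pseudo-differential operators and their pseudo-inverses -/

namespace PseudoDiffOp

variable {B : HarmonicBasis m} (D : PseudoDiffOp B)

/-- The Fourier symbol of the pseudo-inverse, with value `0` on the zeros of the symbol of `D`. -/
def coef (n : ℕ) : ℝ := (D.symbol n)⁻¹

variable {D} in
theorem mem_zeros {n : ℕ} : n ∈ D.zeros ↔ D.symbol n = 0 := by
  simp [zeros]

theorem pinv_eq_tsum (h : TestFun m) (r : Sphere m) :
    D.pinv h r = ∑' n, (D.coef n : ℂ) * B.component n h r := by
  refine tsum_congr fun n => ?_
  simp only [coef, mem_zeros]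
  split_ifs with hn <;> simp [hn]

theorem pinv_of_mem (hm : 1 ≤ m) {k : ℕ} {h : TestFun m} (hh : h ∈ Harm m k) (r : Sphere m) :
    D.pinv h r = D.coef k * h r := by
  rw [pinv_eq_tsum, tsum_eq_single k, B.component_of_mem hh]
  intro n hn
  rw [B.component_of_mem_of_ne hm hn.symm hh]
  exact mul_zero _

theorem greenPartial_eq_sum_kernel (hm : 1 ≤ m) (N : ℕ) (s r : Sphere m) :
    ((D.greenPartial N (inner ℝ (r : Ambient m) (s : Ambient m)) : ℝ) : ℂ) =
      ∑ n ∈ Finset.range N, (D.coef n : ℂ) * B.kernel n s r := by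
  rw [greenPartial, Complex.ofReal_sum]
  refine Finset.sum_congr rfl fun n _ => ?_
  rw [B.kernel_apply_eq_ultraspherical hm, ← Complex.ofReal_mul]
  congr 1
  simp only [coef, mem_zeros]
  split_ifs with hn
  · simp [hn]
  · field_simp

theorem coef_isBigO : D.coef =O[atTop] fun n : ℕ => (n : ℝ) ^ (-D.order) := by
  have hinv := D.growth.2.inv_rev <| by
    filter_upwards [eventually_gt_atTop 0] with n hn hzero
    exact absurd hzero (Real.rpow_pos_of_pos (by exact_mod_cast hn) _).ne'
  simp only [← abs_inv] at hinv
  exact (Asymptotics.isBigO_abs_left.mp hinv).congr_right fun n =>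
    (Real.rpow_neg n.cast_nonneg _).symm

theorem symbol_isBigO : D.symbol =O[atTop] fun n : ℕ => (n : ℝ) ^ D.order :=
  Asymptotics.isBigO_abs_left.mp D.growth.1

theorem toLin_of_mem (hm : 1 ≤ m) {k : ℕ} {h : TestFun m} (hh : h ∈ Harm m k) :
    D.toLin h = (D.symbol k : ℂ) • h := by
  ext r
  refine (D.hasSum h r).unique ?_
  convert hasSum_single k fun n hn => ?_ using 1
  · rw [B.component_of_mem hh, TestFun.smul_apply]
  · rw [B.component_of_mem_of_ne hm hn.symm hh]
    exact mul_zero _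

theorem component_toLin (hm : 1 ≤ m) (φ : TestFun m) (n : ℕ) (s : Sphere m) :
    B.component n (D.toLin φ) s = D.symbol n * B.component n φ s := by
  obtain ⟨u, hu, hle⟩ := B.exists_summable_norm_mul_component_le hm D.symbol_isBigO φ
  have hterm : ∀ k, ∫ r, (D.symbol k : ℂ) * B.component k φ r *
      starRingEnd ℂ (B.kernel n s r) ∂(surface m) =
        D.symbol k * l2inner (B.component k φ) (B.kernel n s) := fun k => by
    simp only [mul_assoc, integral_const_mul, l2inner]
  have hcont : ∀ k, Continuous fun r => (D.symbol k : ℂ) * B.component k φ r := fun k =>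
    continuous_const.mul (B.component k φ).continuous
  have hseries := hasSum_integral_mul (fun k => (hcont k).aestronglyMeasurable) hu hle
    (integrable_of_continuous (Complex.continuous_conj.comp (B.kernel n s).continuous))
  simp only [Function.comp_apply, hterm, (D.hasSum φ _).tsum_eq] at hseries
  rw [← B.l2inner_kernel]
  refine hseries.unique ?_
  convert hasSum_single n fun k hk => ?_ using 1
  · rw [B.l2inner_kernel_of_mem s (B.component_mem n φ)]
  · rw [l2inner_eq_zero_of_ne hm hk (B.component_mem k φ) (B.kernel_mem n s), mul_zero]

theorem pinv_toLin (hm : 1 ≤ m) (hz : D.zeros = ∅) (φ : TestFun m) (s : Sphere m) :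
    D.pinv (D.toLin φ) s = φ s := by
  rw [pinv_eq_tsum, ← B.tsum_component hm φ s]
  refine tsum_congr fun n => ?_
  have hn : D.symbol n ≠ 0 := fun h => by simpa [hz] using mem_zeros.mpr h
  rw [D.component_toLin hm, coef, ← mul_assoc, ← Complex.ofReal_mul, inv_mul_cancel₀ hn,
    Complex.ofReal_one, one_mul]

end PseudoDiffOp

/-! ### Regular generalised functions -/

theorem regular_apply (f : Sphere m → ℂ) (hf : Integrable f (surface m)) (φ : TestFun m) :
    regular f hf φ = ∫ r, f r * φ r ∂(surface m) := rfl

theorem regular_congr {f g : Sphere m → ℂ} (hf : Integrable f (surface m))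
    (hg : Integrable g (surface m)) (h : f =ᵐ[surface m] g) : regular f hf = regular g hg := by
  ext φ
  exact integral_congr_ae (h.mul (EventuallyEq.refl _ φ))

theorem regular_add {f g : Sphere m → ℂ} (hf : Integrable f (surface m))
    (hg : Integrable g (surface m)) :
    regular (fun r => f r + g r) (hf.add hg) = regular f hf + regular g hg := by
  ext φ
  simp only [_root_.add_apply, regular_apply, add_mul]
  exact integral_add (integrable_mul_testFun hf φ) (integrable_mul_testFun hg φ)

theorem regular_const_mul (c : ℂ) {f : Sphere m → ℂ} (hf : Integrable f (surface m)) :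
    regular (fun r => c * f r) (hf.const_mul c) = c • regular f hf := by
  ext φ
  simp only [_root_.smul_apply, regular_apply, mul_assoc, integral_const_mul, smul_eq_mul]

theorem regular_sum {ι : Type*} (t : Finset ι) {f : ι → Sphere m → ℂ}
    (hf : ∀ i, Integrable (f i) (surface m)) :
    regular (fun r => ∑ i ∈ t, f i r) (integrable_finsetSum t fun i _ => hf i) =
      ∑ i ∈ t, regular (f i) (hf i) := by
  ext φ
  simp only [_root_.sum_apply, regular_apply, Finset.sum_mul]
  exact integral_finsetSum t fun i _ => integrable_mul_testFun (hf i) φ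

/-! ### Smoothed Green functions -/

namespace PseudoDiffOp

variable {B : HarmonicBasis m} (D : PseudoDiffOp B)

/-- The Green function at `s`, smoothed by `(Id - ε Δ)^{-m}`; the exponent `m = d - 1` is large
enough for the series to converge uniformly, whatever the order of `D`. -/
def smoothed (s : Sphere m) (ε : ℝ) (r : Sphere m) : ℂ :=
  ∑' n, resolventWeight m ε m n • ((D.coef n : ℂ) * B.kernel n s r)

theorem summable_smoothed_bound (hm : 1 ≤ m) {ε : ℝ} (hε : 0 < ε) :
    Summable fun n => |resolventWeight m ε m n * D.coef n| * (harmDim m n / area m) := by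
  have hdecay : (fun n => resolventWeight m ε m n * D.coef n) =O[atTop]
      fun n : ℕ => (n : ℝ) ^ (-(2 * m : ℝ) + -D.order) := by
    refine ((resolventWeight_isBigO hm hε m).mul D.coef_isBigO).congr' EventuallyEq.rfl ?_
    filter_upwards [eventually_gt_atTop 0] with n hn
    rw [← Real.rpow_add (by exact_mod_cast hn)]
  have : (1 : ℝ) ≤ m := by exact_mod_cast hm
  exact B.summable_mul_harmDim hm hdecay (by linarith [D.order_nonneg])

theorem norm_smoothed_term_le (ε : ℝ) (n : ℕ) (s r : Sphere m) :
    ‖resolventWeight m ε m n • ((D.coef n : ℂ) * B.kernel n s r)‖ ≤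
      |resolventWeight m ε m n * D.coef n| * (harmDim m n / area m) := by
  rw [norm_smul, norm_mul, Complex.norm_real, ← mul_assoc, ← norm_mul, Real.norm_eq_abs]
  exact mul_le_mul_of_nonneg_left (B.norm_kernel_le n s r) (abs_nonneg _)

theorem continuous_smoothed_term (ε : ℝ) (n : ℕ) (s : Sphere m) :
    Continuous fun r => resolventWeight m ε m n • ((D.coef n : ℂ) * B.kernel n s r) :=
  (continuous_const.fun_mul (B.kernel n s).continuous).fun_const_smul _

theorem continuous_smoothed (hm : 1 ≤ m) (s : Sphere m) {ε : ℝ} (hε : 0 < ε) :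
    Continuous (D.smoothed s ε) :=
  continuous_tsum (fun n => D.continuous_smoothed_term ε n s) (D.summable_smoothed_bound hm hε)
    fun n r => D.norm_smoothed_term_le ε n s r

theorem integral_smoothed_mul (hm : 1 ≤ m) (s : Sphere m) {ε : ℝ} (hε : 0 < ε) {k : ℕ}
    {φ : TestFun m} (hφ : φ ∈ Harm m k) :
    ∫ r, D.smoothed s ε r * φ r ∂(surface m) = resolventWeight m ε m k * (D.coef k * φ s) := by
  have hterm : ∀ n, ∫ r, resolventWeight m ε m n • ((D.coef n : ℂ) * B.kernel n s r) * φ r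
      ∂(surface m) = resolventWeight m ε m n * (D.coef n * B.component n φ s) := by
    intro n
    rw [← B.l2inner_kernel, l2inner, ← integral_const_mul, ← integral_const_mul]
    refine integral_congr_ae (ae_of_all _ fun r => ?_)
    simp only [B.kernel_apply_eq_ultraspherical hm, Complex.conj_ofReal, Complex.real_smul]
    ring
  have hseries := hasSum_integral_mul
    (fun n => (D.continuous_smoothed_term ε n s).aestronglyMeasurable)
    (D.summable_smoothed_bound hm hε) (fun n r => D.norm_smoothed_term_le ε n s r)
    (integrable_of_continuous φ.continuous)
  simp only [hterm] at hseries
  refine hseries.unique ?_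
  convert hasSum_single k fun n hn => ?_ using 1
  · rw [B.component_of_mem hφ]
  · rw [B.component_of_mem_of_ne hm hn.symm hφ]
    exact mul_eq_zero_of_right _ (mul_zero _)

theorem tendsto_sum_coef_mul_kernel (hm : 1 ≤ m) {s r : Sphere m}
    (hconv : ∃ l : ℝ,
      Tendsto (fun N => D.greenPartial N (inner ℝ (r : Ambient m) (s : Ambient m))) atTop (𝓝 l)) :
    Tendsto (fun N => ∑ n ∈ Finset.range N, (D.coef n : ℂ) * B.kernel n s r) atTop
      (𝓝 (D.trace s r)) := by
  obtain ⟨l, hl⟩ := hconv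
  simp_rw [trace, greenKernel, hl.limUnder_eq, ← D.greenPartial_eq_sum_kernel hm]
  exact (Complex.continuous_ofReal.tendsto l).comp hl

theorem tendsto_smoothed (hm : 1 ≤ m) {s r : Sphere m}
    (hconv : ∃ l : ℝ,
      Tendsto (fun N => D.greenPartial N (inner ℝ (r : Ambient m) (s : Ambient m))) atTop (𝓝 l)) :
    Tendsto (fun ε => D.smoothed s ε r) (𝓝[>] 0) (𝓝 (D.trace s r)) := by
  have hpos : ∀ᶠ ε : ℝ in 𝓝[>] 0, 0 < ε := eventually_mem_nhdsWithin
  exact tendsto_tsum_smul_of_antitone (D.tendsto_sum_coef_mul_kernel hm hconv)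
    (hpos.mono fun ε hε => antitone_resolventWeight hm hε.le m)
    (hpos.mono fun ε hε n => (resolventWeight_pos hm hε.le m n).le)
    (hpos.mono fun ε hε => resolventWeight_le_one hm hε.le m)
    (fun n => (tendsto_resolventWeight m m n).mono_left nhdsWithin_le_nhds)
    (hpos.mono fun ε hε => (D.summable_smoothed_bound hm hε).of_norm_bounded
      fun n => D.norm_smoothed_term_le ε n s r)

variable {D}

theorem IsGreenFunction.apply_of_mem (hm : 1 ≤ m) {s : Sphere m} {Ψ : GenFun m}
    (hΨ : D.IsGreenFunction s Ψ) {n : ℕ} {φ : TestFun m} (hφ : φ ∈ Harm m n) :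
    Ψ φ = D.coef n * φ s :=
  (hΨ φ).trans (D.pinv_of_mem hm hφ s)

theorem IsGreenFunction.integral_smoothed_mul_sum (hm : 1 ≤ m) {s : Sphere m} {f : Sphere m → ℂ}
    {hf : Integrable f (surface m)} (hG : D.IsGreenFunction s (regular f hf)) {ε : ℝ} (hε : 0 < ε)
    (N : ℕ) {ψ : ℕ → TestFun m} (hψ : ∀ n, ψ n ∈ Harm m n) :
    ∫ r, D.smoothed s ε r * (∑ n ∈ Finset.range N, ψ n) r ∂(surface m) =
      ∫ r, f r * resolvent ε m N ψ r ∂(surface m) := by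
  rw [resolvent, integral_mul_sum (integrable_of_continuous (D.continuous_smoothed hm s hε)),
    integral_mul_sum hf]
  refine Finset.sum_congr rfl fun n _ => ?_
  rw [D.integral_smoothed_mul hm s hε (hψ n), ← regular_apply f hf,
    hG.apply_of_mem hm (Submodule.smul_mem _ _ (hψ n)), TestFun.smul_apply, mul_left_comm]

/-- The adjoint of smoothing does not increase sup norms, so by duality smoothing does not increase
`L¹` norms. -/
theorem IsGreenFunction.integral_norm_smoothed_sub_resolvent_le (hm : 1 ≤ m) {s : Sphere m}
    {f : Sphere m → ℂ} {hf : Integrable f (surface m)} (hG : D.IsGreenFunction s (regular f hf))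
    {ε : ℝ} (hε : 0 < ε) (N : ℕ) {φ : ℕ → TestFun m} (hφ : ∀ n, φ n ∈ Harm m n) :
    ∫ r, ‖D.smoothed s ε r - resolvent ε m N φ r‖ ∂(surface m) ≤
      ∫ r, ‖f r - (∑ n ∈ Finset.range N, φ n) r‖ ∂(surface m) := by
  have hint : ∀ g : TestFun m, Integrable g (surface m) := fun g =>
    integrable_of_continuous g.continuous
  have hsmoothed := D.continuous_smoothed hm s hε
  refine integral_norm_le_of_forall_harmonics hm (hsmoothed.sub (TestFun.continuous _))
    fun h hh C hC => ?_
  obtain ⟨M, ψ, hψ, rfl⟩ := exists_eq_sum_range_of_mem_harmonics hh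
  have hadjoint : ∫ r, (D.smoothed s ε r - resolvent ε m N φ r) *
      (∑ n ∈ Finset.range M, ψ n) r ∂(surface m) =
      ∫ r, (f r - (∑ n ∈ Finset.range N, φ n) r) * resolvent ε m M ψ r ∂(surface m) := by
    simp only [sub_mul]
    rw [integral_sub (integrable_mul_testFun (integrable_of_continuous hsmoothed) _)
      (integrable_mul_testFun (hint _) _), integral_sub (integrable_mul_testFun hf _)
      (integrable_mul_testFun (hint _) _), hG.integral_smoothed_mul_sum hm hε M hψ,
      integral_resolvent_mul_sum hm ε m N M hφ hψ]
  exact hadjoint ▸ norm_integral_mul_le (hf.sub (hint _)) (norm_resolvent_le hm hε.le m M hψ hC)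

theorem IsGreenFunction.tendsto_integral_norm_smoothed_sub (hm : 1 ≤ m) {s : Sphere m}
    {f : Sphere m → ℂ} {hf : Integrable f (surface m)} (hG : D.IsGreenFunction s (regular f hf)) :
    Tendsto (fun ε => ∫ r, ‖D.smoothed s ε r - f r‖ ∂(surface m)) (𝓝[>] 0) (𝓝 0) := by
  rw [Metric.tendsto_nhds]
  intro η hη
  obtain ⟨g, hg, hgf⟩ := exists_mem_harmonics_integral_norm_sub_le hm hf
    (show 0 < η / 4 by positivity)
  obtain ⟨N, φ, hφ, rfl⟩ := exists_eq_sum_range_of_mem_harmonics hg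
  have hresolvent := Metric.tendsto_nhds.mp (tendsto_integral_norm_resolvent_sub m N φ) (η / 4)
    (by positivity)
  filter_upwards [hresolvent.filter_mono nhdsWithin_le_nhds, eventually_mem_nhdsWithin]
    with ε hnear hε
  rw [Real.dist_0_eq_abs, abs_of_nonneg (integral_nonneg fun r => norm_nonneg _)] at hnear ⊢
  have hint : ∀ g : TestFun m, Integrable g (surface m) := fun g =>
    integrable_of_continuous g.continuous
  have hsmoothed := hG.integral_norm_smoothed_sub_resolvent_le hm hε N hφ
  have htriangle := integral_norm_sub_le_add
    (integrable_of_continuous (D.continuous_smoothed hm s hε)) (hint (resolvent ε m N φ)) hf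
  have htriangle' := integral_norm_sub_le_add (hint (resolvent ε m N φ))
    (hint (∑ n ∈ Finset.range N, φ n)) hf
  simp only [norm_sub_rev (f _)] at hgf hsmoothed
  linarith

theorem IsGreenFunction.ae_eq_trace (hm : 1 ≤ m) {s : Sphere m}
    (hconv : ∀ r : Sphere m, ∃ l : ℝ,
      Tendsto (fun N => D.greenPartial N (inner ℝ (r : Ambient m) (s : Ambient m))) atTop (𝓝 l))
    {f : Sphere m → ℂ} {hf : Integrable f (surface m)}
    (hG : D.IsGreenFunction s (regular f hf)) : f =ᵐ[surface m] D.trace s := by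
  obtain ⟨ε, -, hε_pos, hε_lim⟩ := exists_seq_strictAnti_tendsto (0 : ℝ)
  have hε : Tendsto ε atTop (𝓝[>] 0) :=
    tendsto_nhdsWithin_iff.mpr ⟨hε_lim, Eventually.of_forall hε_pos⟩
  have hcont := fun j => D.continuous_smoothed hm s (hε_pos j)
  have hL1 : Tendsto (fun j => eLpNorm (D.smoothed s (ε j) - f) 1 (surface m)) atTop (𝓝 0) := by
    have hlim := ENNReal.tendsto_ofReal ((hG.tendsto_integral_norm_smoothed_sub hm).comp hε)
    rw [ENNReal.ofReal_zero] at hlim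
    refine hlim.congr fun j => ?_
    rw [eLpNorm_one_eq_lintegral_enorm]
    exact ofReal_integral_norm_eq_lintegral_enorm ((integrable_of_continuous (hcont j)).sub hf)
  obtain ⟨ns, hns, hae⟩ := (tendstoInMeasure_of_tendsto_eLpNorm one_ne_zero
    (fun j => (hcont j).aestronglyMeasurable) hf.aestronglyMeasurable hL1).exists_seq_tendsto_ae
  filter_upwards [hae] with r hr
  exact tendsto_nhds_unique hr
    ((D.tendsto_smoothed hm (hconv r)).comp (hε.comp hns.tendsto_atTop))

end PseudoDiffOp

/-! ### Splines -/

theorem HarmonicBasis.sum_apply_conjugate_mul_integral (B : HarmonicBasis m) (u : GenFun m) {n : ℕ}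
    {φ : TestFun m} (hφ : φ ∈ Harm m n) :
    ∑ k, u (B.Y n k).conjugate * ∫ x, B.Y n k x * φ x ∂(surface m) = u φ := by
  conv_rhs => rw [← B.sum_integral_smul_conjugate hφ]
  rw [map_sum]
  exact Finset.sum_congr rfl fun k _ => by rw [map_smul, smul_eq_mul, mul_comm]

theorem HarmonicBasis.sum_apply_conjugate_mul_integral_of_ne (B : HarmonicBasis m) (hm : 1 ≤ m)
    (u : GenFun m) {n n' : ℕ} (hn : n' ≠ n) {φ : TestFun m} (hφ : φ ∈ Harm m n) :
    ∑ k, u (B.Y n' k).conjugate * ∫ x, B.Y n' k x * φ x ∂(surface m) = 0 :=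
  Finset.sum_eq_zero fun k _ => by
    rw [integral_mul_eq_zero_of_ne hm hn (B.mem_Harm n' k) hφ, mul_zero]

namespace PseudoDiffOp

variable {B : HarmonicBasis m} {D : PseudoDiffOp B}

theorem IsSplineAdmissible.integrable_trace (hD : D.IsSplineAdmissible) (hm : 1 ≤ m)
    (s : Sphere m) : Integrable (D.trace s) (surface m) :=
  let ⟨hconv, _, hf, hG⟩ := hD s
  hf.congr (hG.ae_eq_trace hm hconv)

theorem IsSplineAdmissible.isGreenFunction_trace (hD : D.IsSplineAdmissible) (hm : 1 ≤ m)
    (s : Sphere m) :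
    D.IsGreenFunction s (regular (D.trace s) (hD.integrable_trace hm s)) := by
  obtain ⟨hconv, f, hf, hG⟩ := hD s
  rwa [← regular_congr hf (hD.integrable_trace hm s) (hG.ae_eq_trace hm hconv)]

theorem isSpline_iff {M : ℕ} {r : Fin M → Sphere m} {α : Fin M → ℂ} {u : GenFun m} :
    D.IsSpline r α u ↔ ∀ φ, u (D.toLin φ) = ∑ i, α i * φ (r i) := by
  rw [IsSpline, LinearMap.ext_iff]
  refine forall_congr' fun φ => ?_
  simp only [dualApply, LinearMap.comp_apply, ContinuousLinearMap.coe_coe, _root_.sum_apply,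
    _root_.smul_apply, smul_eq_mul]
  rfl

theorem IsSpline.symbol_mul (hm : 1 ≤ m) {M : ℕ} {r : Fin M → Sphere m} {α : Fin M → ℂ}
    {u : GenFun m} (hu : D.IsSpline r α u) {n : ℕ} {φ : TestFun m} (hφ : φ ∈ Harm m n) :
    D.symbol n * u φ = ∑ i, α i * φ (r i) := by
  rw [← isSpline_iff.mp hu φ, D.toLin_of_mem hm hφ, map_smul, smul_eq_mul]

theorem IsSpline.eq_sum (hD : D.IsSplineAdmissible) (hm : 1 ≤ m) {M : ℕ} {r : Fin M → Sphere m}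
    {α : Fin M → ℂ} {u : GenFun m} (hu : D.IsSpline r α u) :
    u = ∑ i, α i • regular (D.trace (r i)) (hD.integrable_trace hm (r i)) +
      ∑ n ∈ D.zeros, ∑ k, u (B.Y n k).conjugate •
        regular (B.Y n k) (integrable_of_continuous (B.Y n k).continuous) := by
  refine genFun_ext hm fun n φ hφ => ?_
  have hgreen : ∑ i, α i * (D.coef n * φ (r i)) = D.coef n * (D.symbol n * u φ) := by
    simp only [hu.symbol_mul hm hφ, Finset.mul_sum, mul_left_comm]
  simp only [_root_.add_apply, _root_.sum_apply, _root_.smul_apply, smul_eq_mul,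
    (hD.isGreenFunction_trace hm _).apply_of_mem hm hφ, hgreen]
  simp only [regular_apply]
  by_cases hn : n ∈ D.zeros
  · rw [Finset.sum_eq_single_of_mem n hn fun k _ hk =>
      B.sum_apply_conjugate_mul_integral_of_ne hm u hk hφ, mem_zeros.mp hn, Complex.ofReal_zero,
      zero_mul, mul_zero, zero_add, B.sum_apply_conjugate_mul_integral u hφ]
  · rw [Finset.sum_eq_zero fun k hk => B.sum_apply_conjugate_mul_integral_of_ne hm u
      (ne_of_mem_of_not_mem hk hn) hφ, add_zero, coef, ← mul_assoc, ← Complex.ofReal_mul,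
      inv_mul_cancel₀ fun h => hn (mem_zeros.mpr h), Complex.ofReal_one, one_mul]

theorem IsSpline.eq_regular (hD : D.IsSplineAdmissible) (hm : 1 ≤ m) {M : ℕ}
    {r : Fin M → Sphere m} {α : Fin M → ℂ} {u : GenFun m} (hu : D.IsSpline r α u) :
    ∃ hF : Integrable (fun x : Sphere m => (∑ i, α i * D.trace (r i) x) +
        ∑ n ∈ D.zeros, ∑ k, u (B.Y n k).conjugate * B.Y n k x) (surface m),
      u = regular _ hF := by
  have heq := hu.eq_sum hD hm
  simp only [← regular_const_mul] at heq
  rw [← regular_sum] at heq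
  simp only [← regular_sum] at heq
  exact ⟨_, heq.trans (regular_add _ _).symm⟩

theorem isSpline_iff_eq_sum (hD : D.IsSplineAdmissible) (hm : 1 ≤ m) (hz : D.zeros = ∅) {M : ℕ}
    {r : Fin M → Sphere m} {α : Fin M → ℂ} {u : GenFun m} :
    D.IsSpline r α u ↔
      u = ∑ i, α i • regular (D.trace (r i)) (hD.integrable_trace hm (r i)) := by
  refine ⟨fun hu => ?_, ?_⟩
  · simpa only [hz, Finset.sum_empty, add_zero] using hu.eq_sum hD hm
  · rintro rfl
    refine isSpline_iff.mpr fun φ => ?_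
    simp only [_root_.sum_apply, _root_.smul_apply, smul_eq_mul,
      hD.isGreenFunction_trace hm _ (D.toLin φ), D.pinv_toLin hm hz]

theorem IsSpline.eq_regular_of_zeros_eq_empty (hD : D.IsSplineAdmissible) (hm : 1 ≤ m)
    (hz : D.zeros = ∅) {M : ℕ} {r : Fin M → Sphere m} {α : Fin M → ℂ} {u : GenFun m}
    (hu : D.IsSpline r α u) :
    ∃ hF : Integrable (fun x : Sphere m => ∑ i, α i * D.trace (r i) x) (surface m),
      u = regular _ hF := by
  have heq := (isSpline_iff_eq_sum hD hm hz).mp hu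
  simp only [← regular_const_mul] at heq
  exact ⟨_, heq.trans (regular_sum _ _).symm⟩

theorem splineSpace_eq_span (hD : D.IsSplineAdmissible) (hm : 1 ≤ m) (hz : D.zeros = ∅) {M : ℕ}
    (r : Fin M → Sphere m) :
    D.splineSpace r = Submodule.span ℂ
      (Set.range fun i => regular (D.trace (r i)) (hD.integrable_trace hm (r i))) := by
  ext u
  rw [Submodule.mem_span_range_iff_exists_fun]
  exact exists_congr fun α => (isSpline_iff_eq_sum hD hm hz).trans eq_comm

theorem norm_trace_le (hm : 1 ≤ m) (hp : (m : ℝ) < D.order) {s r : Sphere m}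
    (hconv : ∃ l : ℝ,
      Tendsto (fun N => D.greenPartial N (inner ℝ (r : Ambient m) (s : Ambient m))) atTop (𝓝 l)) :
    ‖D.trace s r‖ ≤ ∑' n, |D.coef n| * (harmDim m n / area m) := by
  have hsum := B.summable_mul_harmDim hm D.coef_isBigO (by linarith)
  refine le_of_tendsto (D.tendsto_sum_coef_mul_kernel hm hconv).norm
    (Eventually.of_forall fun N => ?_)
  refine (norm_sum_le _ _).trans ((Finset.sum_le_sum fun n _ => ?_).trans
    (hsum.sum_le_tsum _ fun n _ => mul_nonneg (abs_nonneg _)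
      (div_nonneg (Nat.cast_nonneg _) (area_pos m).le)))
  rw [norm_mul, Complex.norm_real, Real.norm_eq_abs]
  exact mul_le_mul_of_nonneg_left (B.norm_kernel_le n s r) (abs_nonneg _)

theorem IsSplineAdmissible.memLp_trace (hD : D.IsSplineAdmissible) (hm : 1 ≤ m)
    (hp : (m : ℝ) < D.order) (s : Sphere m) (q : ENNReal) : MemLp (D.trace s) q (surface m) :=
  MemLp.of_bound (hD.integrable_trace hm s).aestronglyMeasurable _
    (ae_of_all _ fun r => norm_trace_le hm hp ((hD s).1 r))

end PseudoDiffOp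

end Spherical

end

theorem proposition5 (m : ℕ) (hm : 1 ≤ m) (B : Spherical.HarmonicBasis m)
    (D : Spherical.PseudoDiffOp B) (hD : D.IsSplineAdmissible)
    (M : ℕ) (r : Fin M → Spherical.Sphere m) :
    (∀ (s : Spherical.GenFun m) (α : Fin M → ℂ), D.IsSpline r α s →
      ∃ hF : Integrable (fun x : Spherical.Sphere m =>
          (∑ i, α i * D.trace (r i) x) +
            ∑ n ∈ D.zeros, ∑ k, s (B.Y n k).conjugate * B.Y n k x) (Spherical.surface m),
        s = Spherical.regular _ hF) ∧
    (D.zeros = ∅ →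
      (∀ (s : Spherical.GenFun m) (α : Fin M → ℂ), D.IsSpline r α s →
        ∃ hF : Integrable (fun x : Spherical.Sphere m => ∑ i, α i * D.trace (r i) x)
            (Spherical.surface m),
          s = Spherical.regular _ hF) ∧
      (∃ hψ : ∀ i, Integrable (D.trace (r i)) (Spherical.surface m),
        D.splineSpace r =
          Submodule.span ℂ (Set.range fun i => Spherical.regular (D.trace (r i)) (hψ i))) ∧
      ((m : ℝ) < D.order → ∀ i, MemLp (D.trace (r i)) 2 (Spherical.surface m))) := by
  refine ⟨fun s α hs => hs.eq_regular hD hm, fun hz =>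
    ⟨fun s α hs => hs.eq_regular_of_zeros_eq_empty hD hm hz, ?_, fun hp i => ?_⟩⟩
  · exact ⟨fun i => hD.integrable_trace hm (r i),
      Spherical.PseudoDiffOp.splineSpace_eq_span hD hm hz r⟩
  · exact hD.memLp_trace hm hp (r i) 2
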